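/- Let $d\ge 2$, let $t_1<t_2<\dots<t_{2d+3}$ be real numbers, and let $C=C(2d+3,2d)\subset\mathbb R^{2d}$ be the cyclic polytope that is the convex hull of the points $p_i=(t_i,t_i^2,\dots,t_i^{2d})$, $1\le i\le 2d+3$. A triangulation of $C$ is a collection of $2d$-dimensional simplices with vertices among the $p_i$ which cover $C$ and any two of which meet in a common (possibly empty) face. An internal $d$-simplex of $C$ is a $d$-dimensional simplex with vertices among the $p_i$ that is not contained in the boundary of $C$. Let $\Delta^d_2$ be the simplicial complex on the set of internal $d$-simplices of $C$ whose faces are the nonempty sets of internal $d$-simplices that are all faces of simplices of one common triangulation of $C$; that is, $\Delta^d_2$ is generated by the sets of internal $d$-simplices of the triangulations of $C$. A simplicial complex is called shellable if its maximal faces can be ordered $F_1,\dots,F_p$ so that for every $i>1$ the intersection of $F_i$ with $\bigcup_{j<i}F_j$ (as simplicial complexes) is a non-empty union of codimension one faces of $F_i$. Then every maximal face of $\Delta^d_2$ has exactly $d+1$ vertices, and $\Delta^d_2$ is not shellable. Moreover, the internal $d$-simplices of $C$ can be arranged in a cycle $c_0,c_1,\dots,c_{2d+2}$ (indices modulo $2d+3$,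 each internal $d$-simplex occurring exactly once) such that the one-dimensional complex with edges $\{c_i,c_{i+1}\}$ is a subcomplex of $\Delta^d_2$ and its geometric realization is a (strong) deformation retract of that of $\Delta^d_2$. In particular the geometric realization of $\Delta^d_2$ is homotopy equivalent to the circle $S^1$. -/

import Mathlib

open scoped ContinuousMap

namespace CyclicPolytope

/-- The point `p_s = (s, s², …, s^δ)` of the moment curve in `ℝ^δ`. -/
def momentCurve (δ : ℕ) (s : ℝ) : Fin δ → ℝ := fun k => s ^ ((k : ℕ) + 1)

/-- The convex hull of the points `p_{t i}`, `i ∈ A`. When `|A| ≤ δ + 1` and `t` is injective this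
is a simplex of dimension `|A| - 1` with vertex set indexed by `A`. -/
def hull (δ : ℕ) {m : ℕ} (t : Fin m → ℝ) (A : Set (Fin m)) : Set (Fin δ → ℝ) :=
  convexHull ℝ ((fun i => momentCurve δ (t i)) '' A)

/-- The cyclic polytope `C(m, δ)`, realised with the parameters `t`. -/
def polytope (δ : ℕ) {m : ℕ} (t : Fin m → ℝ) : Set (Fin δ → ℝ) := hull δ t Set.univ

/-- `T`, a collection of `(δ + 1)`-subsets of the index set, is (the set of top-dimensional
simplices of) a triangulation of `C(m, δ)`: the simplices cover the polytope, and any two of them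
meet in a common face. -/
structure IsTriangulation (δ : ℕ) {m : ℕ} (t : Fin m → ℝ) (T : Set (Finset (Fin m))) : Prop where
  card_eq : ∀ S ∈ T, S.card = δ + 1
  cover : ⋃ S ∈ T, hull δ t (S : Set (Fin m)) = polytope δ t
  inter : ∀ S ∈ T, ∀ S' ∈ T,
    hull δ t (S : Set (Fin m)) ∩ hull δ t (S' : Set (Fin m)) =
      hull δ t ((S : Set (Fin m)) ∩ (S' : Set (Fin m)))

/-- `A` is an internal `d`-simplex of `C(m, 2d)`: a `d`-simplex whose vertices are vertices of the
polytope and which does not lie on the boundary of the polytope. -/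
def IsInternal (d : ℕ) {m : ℕ} (t : Fin m → ℝ) (A : Finset (Fin m)) : Prop :=
  A.card = d + 1 ∧ ¬ hull (2 * d) t (A : Set (Fin m)) ⊆ frontier (polytope (2 * d) t)

/-- The type of internal `d`-simplices of `C(m, 2d)`. -/
abbrev InternalSimplex (d : ℕ) {m : ℕ} (t : Fin m → ℝ) : Type :=
  {A : Finset (Fin m) // IsInternal d t A}

/-- The set of internal `d`-simplices of `C(m, 2d)` that are faces of the triangulation `T`. -/
def internalFaces (d : ℕ) {m : ℕ} (t : Fin m → ℝ) (T : Set (Finset (Fin m))) :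
    Set (InternalSimplex d t) :=
  {A | ∃ S ∈ T, A.1 ⊆ S}

/-- The simplicial complex on the internal `d`-simplices of `C(m, 2d)` generated by the sets of
internal `d`-simplices of triangulations of `C(m, 2d)`. For `m = n + 2d + 1` it is `Δ^d_n`. -/
def triangulationComplex (d : ℕ) {m : ℕ} (t : Fin m → ℝ) :
    PreAbstractSimplicialComplex (InternalSimplex d t) where
  faces := {σ | σ.Nonempty ∧
    ∃ T, IsTriangulation (2 * d) t T ∧ (σ : Set (InternalSimplex d t)) ⊆ internalFaces d t T}
  isRelLowerSet_faces := by
    rintro σ ⟨hσ, T, hT, hsub⟩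
    exact ⟨hσ, fun τ hτ hne => ⟨hne, T, hT, fun x hx => hsub (hτ hx)⟩⟩

end CyclicPolytope

namespace PreAbstractSimplicialComplex

variable {V : Type*}

/-- The maximal faces of a complex. -/
def IsFacet (K : PreAbstractSimplicialComplex V) (F : Finset V) : Prop :=
  Maximal (fun σ => σ ∈ K.faces) F

/-- All maximal faces have `d + 1` vertices. -/
def IsPureOfDim (K : PreAbstractSimplicialComplex V) (d : ℕ) : Prop :=
  ∀ F, K.IsFacet F → F.card = d + 1

/-- The maximal faces admit an order `F 0, F 1, …` such that, for every `i > 0`, the intersection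
of (the full simplex on) `F i` with the union of the earlier `F j` is a non-empty union of
codimension one faces of `F i`. -/
def IsShellable (K : PreAbstractSimplicialComplex V) : Prop :=
  ∃ (p : ℕ) (F : Fin p → Finset V), Function.Injective F ∧
    Set.range F = {G | K.IsFacet G} ∧
    ∀ i : Fin p, 0 < (i : ℕ) →
      ∃ ℋ : Set (Finset V), ℋ.Nonempty ∧
        (∀ H ∈ ℋ, H ⊆ F i ∧ H.card + 1 = (F i).card) ∧
        {G : Finset V | G.Nonempty ∧ G ⊆ F i ∧ ∃ j < i, G ⊆ F j} =
          {G : Finset V | G.Nonempty ∧ ∃ H ∈ ℋ, G ⊆ H}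

/-- The geometric realization of a complex on a finite set, in barycentric coordinates: the convex
combinations of vertices whose support is a face. -/
def realization [Finite V] (K : PreAbstractSimplicialComplex V) : Set (V → ℝ) :=
  {x | (∀ v, 0 ≤ x v) ∧ ∃ σ ∈ K.faces, (∀ v, v ∉ σ → x v = 0) ∧ ∑ v ∈ σ, x v = 1}

/-- The one-dimensional complex of the closed polygon through `c 0, c 1, …, c (n - 1)`: its faces
are the vertices `{c i}` and the edges `{c i, c (i + 1)}`. -/
def cycle {n : ℕ} (c : ZMod n → V) : PreAbstractSimplicialComplex V where
  faces := {σ | σ.Nonempty ∧ ∃ i, ∀ v ∈ σ, v = c i ∨ v = c (i + 1)}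
  isRelLowerSet_faces := by
    rintro σ ⟨hσ, i, hi⟩
    exact ⟨hσ, fun τ hτ hne => ⟨hne, i, fun v hv => hi v (hτ hv)⟩⟩

end PreAbstractSimplicialComplex

/-- `Y` is a (strong) deformation retract of `X`. -/
def IsDeformationRetract {E : Type*} [TopologicalSpace E] (Y X : Set E) : Prop :=
  Y ⊆ X ∧ ∃ H : C(unitInterval × X, X),
    (∀ x : X, H (0, x) = x) ∧ (∀ x : X, (H (1, x) : E) ∈ Y) ∧
    ∀ (s : unitInterval) (x : X), (x : E) ∈ Y → H (s, x) = x

/-! The affine dependences of `2d + 3` points on the moment curve in dimension `2d` form a plane,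
spanned by products of the nodal weights with polynomials of degree at most one. The Gale dual is
thus a configuration of plane vectors `w i • (1, t i)`. Because the weights alternate in sign, the
order of these vectors by argument is `0, 2, 4, …, 1, 3, …`, and each vector makes a positive turn
with the `d + 1` that follow it (`galeDet_ray_pos`). Everything about `C` is then read off from this
cyclic order.

A `d`-simplex is internal exactly when the `d + 2` vectors it omits are consecutive, which gives the
cyclic labelling by `2d + 3` arcs. A `2d`-simplex omits two vectors, hence spans a dual cone. For a
triangulation one chamber between neighbouring rays `k`, `k + 1` is itself the cone of a simplex
(`exists_chamber_mem`), and no simplex has a cone separated from it (`dep_eq_zero`). So an internal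
simplex of the triangulation has an omitted arc containing both `k` and `k + 1`, which leaves `d +
1` consecutive labels; the chamber triangulation realises all of them. Hence the faces are the
nonempty subsets of the arcs of `d + 1` consecutive points on a cycle of length `2d + 3`
(`isArcComplex_triangulationComplex`).

The rest is about this arc complex. Facets meeting in codimension one are neighbours on the cycle,
and the last two facets of a supposed shelling give a contradiction. Since an arc is less than half
the cycle, the mean position of a mass on it is a well-defined point of the circle; moving each mass
straight to the corresponding point of the polygon is the deformation retraction. -/

namespace CyclicPolytope

open Finset Polynomial

/-! ### The Gale dual of the moment curve points. -/

section GaleDual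

variable {d : ℕ} {t : Fin (2 * d + 3) → ℝ}

/-- An affine dependence of the points `p_{t i}`, in terms of the power sums. -/
def IsMomentDep (d : ℕ) (t : Fin (2 * d + 3) → ℝ) (l : Fin (2 * d + 3) → ℝ) : Prop :=
  ∀ k ≤ 2 * d, ∑ i, l i * t i ^ k = 0

theorem isMomentDep_iff {l : Fin (2 * d + 3) → ℝ} :
    IsMomentDep d t l ↔ ∑ i, l i = 0 ∧ ∑ i, l i • momentCurve (2 * d) (t i) = 0 := by
  constructor
  · intro h
    refine ⟨by simpa using h 0 (Nat.zero_le _), ?_⟩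
    ext k
    simpa [momentCurve, Finset.sum_apply] using h (k + 1) k.2
  · rintro ⟨h0, h1⟩ k hk
    rcases k with _ | k
    · simpa using h0
    · simpa [momentCurve, Finset.sum_apply] using congrFun h1 ⟨k, hk⟩

theorem IsMomentDep.sum_mul_eval {l : Fin (2 * d + 3) → ℝ} (h : IsMomentDep d t l)
    {f : ℝ[X]} (hf : f.natDegree ≤ 2 * d) : ∑ i, l i * f.eval (t i) = 0 := by
  simp_rw [eval_eq_sum_range' (Nat.lt_succ_of_le hf), mul_sum]
  rw [sum_comm]
  refine sum_eq_zero fun k hk => ?_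
  have := h k (Nat.lt_succ_iff.mp (mem_range.mp hk))
  calc ∑ i, l i * (f.coeff k * t i ^ k) = f.coeff k * ∑ i, l i * t i ^ k := by
        rw [mul_sum]; exact sum_congr rfl fun i _ => by ring
    _ = 0 := by rw [this, mul_zero]

/-- The nodal weights: the dependences are their products with the values of polynomials of degree
at most one. -/
noncomputable def weight (t : Fin (2 * d + 3) → ℝ) (i : Fin (2 * d + 3)) : ℝ :=
  ∏ j ∈ univ.erase i, (t i - t j)⁻¹

/-- The determinant of two vectors of the Gale dual. -/
noncomputable def galeDet (t : Fin (2 * d + 3) → ℝ) (a b : Fin (2 * d + 3)) : ℝ :=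
  weight t a * weight t b * (t b - t a)

theorem galeDet_swap (a b : Fin (2 * d + 3)) : galeDet t b a = -galeDet t a b := by
  unfold galeDet; ring

theorem galeDet_self (a : Fin (2 * d + 3)) : galeDet t a a = 0 := by
  unfold galeDet; ring

/-- The weighted sum of the values of a polynomial is the coefficient of degree `2d + 2` of its
Lagrange interpolant, and the polynomial `P` below has degree at most `2d + 1`. -/
theorem isMomentDep_galeDet_right (ht : StrictMono t) (r : Fin (2 * d + 3)) :
    IsMomentDep d t (fun i => galeDet t i r) := by
  intro k hk
  set P : ℝ[X] := C (weight t r) * (C (t r) - X) * X ^ k with hP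
  have hdeg : P.natDegree ≤ 2 * d + 1 := by
    have h1 : (C (t r) - X : ℝ[X]).natDegree ≤ 1 := by
      refine (natDegree_sub_le _ _).trans ?_
      simp
    calc P.natDegree ≤ (C (weight t r) * (C (t r) - X)).natDegree + (X ^ k : ℝ[X]).natDegree :=
          natDegree_mul_le
      _ ≤ 1 + k := by
          gcongr
          · exact (natDegree_C_mul_le _ _).trans h1
          · simp
      _ ≤ 2 * d + 1 := by omega
  have hcard : (univ : Finset (Fin (2 * d + 3))).card = 2 * d + 3 := by simp
  have hlt : P.degree < ((univ : Finset (Fin (2 * d + 3))).card : ℕ) := by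
    rw [hcard]
    refine lt_of_le_of_lt degree_le_natDegree ?_
    exact_mod_cast by omega
  have key := Lagrange.coeff_eq_sum (s := univ) (ht.injective.injOn) hlt
  rw [hcard, coeff_eq_zero_of_natDegree_lt (by omega)] at key
  rw [key]
  refine sum_congr rfl fun i _ => ?_
  simp only [galeDet, weight, hP, eval_mul, eval_C, eval_sub, eval_X, eval_pow, prod_inv_distrib]
  ring

theorem IsMomentDep.smul {l : Fin (2 * d + 3) → ℝ} (h : IsMomentDep d t l) (c : ℝ) :
    IsMomentDep d t (fun i => c * l i) := by
  intro k hk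
  simp_rw [mul_assoc, ← mul_sum, h k hk, mul_zero]

theorem IsMomentDep.add {l l' : Fin (2 * d + 3) → ℝ} (h : IsMomentDep d t l)
    (h' : IsMomentDep d t l') : IsMomentDep d t (fun i => l i + l' i) := by
  intro k hk
  simp_rw [add_mul, sum_add_distrib, h k hk, h' k hk, add_zero]

theorem isMomentDep_galeDet_left (ht : StrictMono t) (r : Fin (2 * d + 3)) :
    IsMomentDep d t (fun i => galeDet t r i) := by
  have := (isMomentDep_galeDet_right ht r).smul (-1)
  simpa only [neg_one_mul, ← galeDet_swap] using this

theorem weight_mul_eval (ht : StrictMono t) {a b c : Fin (2 * d + 3)} (hbc : b ≠ c)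
    {s : Finset (Fin (2 * d + 3))} (hs : insert b (insert c s) = univ.erase a)
    (hb : b ∉ s) (hc : c ∉ s) :
    weight t a * ((t a - t b) * ((t a - t c) * ∏ j ∈ s, (t a - t j))) = 1 := by
  have : ∏ j ∈ univ.erase a, (t a - t j) = (t a - t b) * ((t a - t c) * ∏ j ∈ s, (t a - t j)) := by
    rw [← hs, prod_insert (by simp [hb, hbc]), prod_insert hc]
  rw [← this, weight, prod_inv_distrib]
  refine inv_mul_cancel₀ (prod_ne_zero_iff.mpr fun j hj => sub_ne_zero.mpr ?_)
  exact fun h => (mem_erase.mp hj).1 (ht.injective h).symm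

/-- The three-term relation between the values of a dependence. -/
theorem IsMomentDep.three_term (ht : StrictMono t) {l : Fin (2 * d + 3) → ℝ}
    (h : IsMomentDep d t l) (a b c : Fin (2 * d + 3)) :
    galeDet t a b * l c + galeDet t b c * l a + galeDet t c a * l b = 0 := by
  by_cases hab : a = b
  · subst hab; rw [galeDet_self, galeDet_swap a c]; ring
  by_cases hac : a = c
  · subst hac; rw [galeDet_self, galeDet_swap a b]; ring
  by_cases hbc : b = c
  · subst hbc; rw [galeDet_self, galeDet_swap a b]; ring
  set s : Finset (Fin (2 * d + 3)) := {a, b, c}ᶜ with hs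
  have ha : a ∉ s := by simp [hs]
  have hb : b ∉ s := by simp [hs]
  have hc : c ∉ s := by simp [hs]
  -- A test polynomial of the largest admissible degree `2d` that vanishes at all nodes except `a`,
  -- `b`, `c`. Its values there are inverse weights up to linear factors.
  set f : ℝ[X] := ∏ j ∈ s, (X - C (t j)) with hf
  have hcard : s.card = 2 * d := by
    rw [hs, card_compl, card_eq_three.mpr ⟨a, b, c, hab, hac, hbc, rfl⟩]; simp
  have hdeg : f.natDegree ≤ 2 * d := by
    rw [hf, natDegree_prod_of_monic _ _ fun j _ => monic_X_sub_C _]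
    simp [hcard]
  have heval : ∀ x, f.eval x = ∏ j ∈ s, (x - t j) := fun x => by simp [hf, eval_prod]
  have hsum := h.sum_mul_eval hdeg
  have hsum' : l a * f.eval (t a) + l b * f.eval (t b) + l c * f.eval (t c) = 0 := by
    rw [← hsum, ← sum_subset (subset_univ ({a, b, c} : Finset (Fin (2 * d + 3))))]
    · rw [sum_insert (by simp [hab, hac]), sum_insert (by simp [hbc]), sum_singleton]; ring
    · intro j _ hj
      rw [heval, prod_eq_zero (i := j) (by simpa [hs] using hj) (sub_self _), mul_zero]
  have h1 := weight_mul_eval ht (a := a) hbc (s := s) (by ext j; simp [hs]; grind) hb hc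
  have h2 := weight_mul_eval ht (a := b) hac (s := s) (by ext j; simp [hs]; grind) ha hc
  have h3 := weight_mul_eval ht (a := c) hab (s := s)
    (by ext j; simp [hs]; grind) ha hb
  rw [← heval] at h1 h2 h3
  unfold galeDet
  set A := f.eval (t a)
  set B := f.eval (t b)
  set G := f.eval (t c)
  have e1 : weight t b * weight t c * (t c - t b) * l a =
      weight t a * weight t b * weight t c * (t a - t b) * (t a - t c) * (t c - t b) *
        (l a * A) := by
    linear_combination (-weight t b * weight t c * (t c - t b) * l a) * h1
  have e2 : weight t c * weight t a * (t a - t c) * l b =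
      weight t a * weight t b * weight t c * (t a - t b) * (t a - t c) * (t c - t b) *
        (l b * B) := by
    linear_combination (-weight t c * weight t a * (t a - t c) * l b) * h2
  have e3 : weight t a * weight t b * (t b - t a) * l c =
      weight t a * weight t b * weight t c * (t a - t b) * (t a - t c) * (t c - t b) *
        (l c * G) := by
    linear_combination (-weight t a * weight t b * (t b - t a) * l c) * h3
  rw [e1, e2, e3]
  linear_combination (weight t a * weight t b * weight t c * (t a - t b) * (t a - t c) *
    (t c - t b)) * hsum'

/-- The space of dependences is two-dimensional. This is the source of uniqueness of coordinates on
a `2d`-simplex. -/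
theorem IsMomentDep.eq_zero (ht : StrictMono t) {l : Fin (2 * d + 3) → ℝ}
    (h : IsMomentDep d t l) {a b : Fin (2 * d + 3)} (hab : galeDet t a b ≠ 0) (ha : l a = 0)
    (hb : l b = 0) (c : Fin (2 * d + 3)) : l c = 0 := by
  have := h.three_term ht a b c
  rw [ha, hb] at this
  simpa [hab] using this

/-- The negative factors come from the `2d + 2 - i` larger nodes, a number of the same parity as
`i`. -/
theorem weight_sign (ht : StrictMono t) (i : Fin (2 * d + 3)) : 0 < (-1) ^ (i : ℕ) * weight t i := by
  have hsplit : univ.erase i = Iio i ∪ Ioi i := by ext j; simp [lt_or_lt_iff_ne]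
  have hdisj : Disjoint (Iio i) (Ioi i) := by
    rw [Finset.disjoint_left]; intro j hj hj'
    exact lt_asymm (mem_Iio.mp hj) (mem_Ioi.mp hj')
  have h1 : 0 < ∏ j ∈ Iio i, (t i - t j)⁻¹ :=
    prod_pos fun j hj => inv_pos.mpr (sub_pos.mpr (ht (mem_Iio.mp hj)))
  have h2 : 0 < ∏ j ∈ Ioi i, (t j - t i)⁻¹ :=
    prod_pos fun j hj => inv_pos.mpr (sub_pos.mpr (ht (mem_Ioi.mp hj)))
  have h3 : ∏ j ∈ Ioi i, (t i - t j)⁻¹ = (-1) ^ (2 * d + 2 - (i : ℕ)) * ∏ j ∈ Ioi i, (t j - t i)⁻¹ := by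
    have : (2 * d + 2 - (i : ℕ)) = (Ioi i).card := by rw [Fin.card_Ioi]; omega
    rw [this, ← prod_const, ← prod_mul_distrib]
    exact prod_congr rfl fun j _ => by rw [← neg_sub, inv_neg]; ring
  rw [weight, hsplit, prod_union hdisj, h3]
  have h4 : ((-1 : ℝ)) ^ (i : ℕ) * (-1) ^ (2 * d + 2 - (i : ℕ)) = 1 := by
    rw [← pow_add, show (i : ℕ) + (2 * d + 2 - i) = 2 * (d + 1) by omega, pow_mul]; simp
  calc (0 : ℝ) < (∏ j ∈ Iio i, (t i - t j)⁻¹) * ∏ j ∈ Ioi i, (t j - t i)⁻¹ := mul_pos h1 h2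
    _ = ((-1 : ℝ) ^ (i : ℕ) * (-1) ^ (2 * d + 2 - (i : ℕ))) *
          ((∏ j ∈ Iio i, (t i - t j)⁻¹) * ∏ j ∈ Ioi i, (t j - t i)⁻¹) := by rw [h4, one_mul]
    _ = _ := by ring

/-- The cyclic order of the vectors of the Gale dual by argument. -/
def ray (d : ℕ) : ZMod (2 * d + 3) ≃ Fin (2 * d + 3) where
  -- Vectors of even index point to the right and those of odd index to the left, each family
  -- turning as `t` grows, so a step in argument is a step of two in index modulo `2d + 3`. The
  -- inverse of `2` is `d + 2`.
  toFun k := ⟨(2 * k).val, ZMod.val_lt _⟩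
  invFun i := ((d + 2 : ℕ) : ZMod (2 * d + 3)) * (i : ℕ)
  left_inv k := by
    have h : ((2 * d + 3 : ℕ) : ZMod (2 * d + 3)) = 0 := ZMod.natCast_self _
    push_cast at h
    simp only [ZMod.natCast_val, ZMod.cast_id', id]
    push_cast
    linear_combination k * h
  right_inv i := by
    have h : ((2 * d + 3 : ℕ) : ZMod (2 * d + 3)) = 0 := ZMod.natCast_self _
    push_cast at h
    ext
    have : (2 * (((d + 2 : ℕ) : ZMod (2 * d + 3)) * (i : ℕ))) = ((i : ℕ) : ZMod (2 * d + 3)) := by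
      push_cast
      linear_combination ((i : ℕ) : ZMod (2 * d + 3)) * h
    simp only [this]
    exact ZMod.val_cast_of_lt i.2

/-- If the index does not wrap around, the weights have equal signs and the node increases; if it
wraps, the parity changes and the node decreases. The two sign changes cancel. -/
theorem galeDet_ray_pos (ht : StrictMono t) (k : ZMod (2 * d + 3)) {j : ℕ} (h1 : 1 ≤ j)
    (h2 : j ≤ d + 1) : 0 < galeDet t (ray d k) (ray d (k + j)) := by
  set a := ray d k with ha
  set b := ray d (k + j) with hb
  have hav : (a : ℕ) = (2 * k).val := rfl
  have hbv : (b : ℕ) = ((2 * k).val + 2 * j) % (2 * d + 3) := by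
    have : (b : ℕ) = (2 * (k + j)).val := rfl
    rw [this, show 2 * (k + (j : ZMod (2 * d + 3))) = 2 * k + ((2 * j : ℕ) : ZMod (2 * d + 3)) by
      push_cast; ring, ZMod.val_add, ZMod.val_cast_of_lt (by omega)]
  have hsa := weight_sign ht a
  have hsb := weight_sign ht b
  have hmul := mul_pos hsa hsb
  have hlt := a.2
  unfold galeDet
  by_cases hc : (a : ℕ) + 2 * j < 2 * d + 3
  · rw [← hav, Nat.mod_eq_of_lt hc] at hbv
    have hab : a < b := by rw [Fin.lt_def]; omega
    have hp : ((-1 : ℝ)) ^ (b : ℕ) = (-1) ^ (a : ℕ) := by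
      rw [hbv, pow_add, pow_mul]; simp
    rw [hp] at hmul
    have hq : ((-1 : ℝ)) ^ (a : ℕ) * (-1) ^ (a : ℕ) = 1 := by
      rw [← mul_pow]; simp
    refine mul_pos ?_ (sub_pos.mpr (ht hab))
    calc (0 : ℝ) < _ := hmul
      _ = ((-1 : ℝ) ^ (a : ℕ) * (-1) ^ (a : ℕ)) * (weight t a * weight t b) := by ring
      _ = _ := by rw [hq, one_mul]
  · rw [← hav, Nat.mod_eq_sub_mod (by omega), Nat.mod_eq_of_lt (by omega)] at hbv
    have hab : b < a := by rw [Fin.lt_def]; omega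
    have hq : ((-1 : ℝ)) ^ (a : ℕ) * (-1) ^ (b : ℕ) = -1 := by
      rw [← pow_add, show (a : ℕ) + b = 2 * (a + j - d - 2) + 1 by omega, pow_succ, pow_mul]; simp
    have hneg : weight t a * weight t b < 0 := by
      have : (0 : ℝ) < -(weight t a * weight t b) := by
        calc (0 : ℝ) < _ := hmul
          _ = ((-1 : ℝ) ^ (a : ℕ) * (-1) ^ (b : ℕ)) * (weight t a * weight t b) := by ring
          _ = _ := by rw [hq, neg_one_mul]
      linarith
    exact mul_pos_of_neg_of_neg hneg (sub_neg.mpr (ht hab))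

/-- The Euclidean length of a vector of the Gale dual. -/
noncomputable def galeNorm (t : Fin (2 * d + 3) → ℝ) (i : Fin (2 * d + 3)) : ℝ :=
  ‖(⟨weight t i, weight t i * t i⟩ : ℂ)‖

theorem galeNorm_pos (ht : StrictMono t) (i : Fin (2 * d + 3)) : 0 < galeNorm t i := by
  refine norm_pos_iff.mpr fun h => ?_
  have h0 : weight t i = 0 := congrArg Complex.re h
  simpa [h0] using weight_sign ht i

/-- Strict convexity of the Euclidean norm, for a vector in the open cone of two others. -/
theorem galeNorm_lt {a b c : Fin (2 * d + 3)} (hab : 0 < galeDet t a b)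
    (hac : 0 < galeDet t a c) (hcb : 0 < galeDet t c b) :
    galeDet t a b * galeNorm t c < galeDet t c b * galeNorm t a + galeDet t a c * galeNorm t b := by
  set z : Fin (2 * d + 3) → ℂ := fun i => ⟨weight t i, weight t i * t i⟩ with hz
  have hrel : (galeDet t a b : ℝ) • z c = (galeDet t c b : ℝ) • z a + (galeDet t a c : ℝ) • z b := by
    apply Complex.ext <;> simp [hz, galeDet] <;> ring
  have hnot : ¬ SameRay ℝ ((galeDet t c b : ℝ) • z a) ((galeDet t a c : ℝ) • z b) := by
    intro h
    have hD : weight t a ≠ 0 ∧ weight t b ≠ 0 ∧ t b - t a ≠ 0 := by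
      have := hab.ne'
      simpa [galeDet, and_assoc] using this
    rcases h with h | h | ⟨r, s, hr, hs, h⟩
    · have := congrArg Complex.re h
      simp [hz, hcb.ne', hD.1] at this
    · have := congrArg Complex.re h
      simp [hz, hac.ne', hD.2.1] at this
    · have hre := congrArg Complex.re h
      have him := congrArg Complex.im h
      simp only [hz, Complex.smul_re, Complex.smul_im, smul_eq_mul] at hre him
      have : r * galeDet t c b * weight t a * (t b - t a) = 0 := by
        linear_combination t b * hre - him
      simp [hr.ne', hcb.ne', hD.1, hD.2.2] at this
  have h := norm_add_lt_of_not_sameRay hnot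
  rw [← hrel, norm_smul, norm_smul, norm_smul, Real.norm_of_nonneg hab.le,
    Real.norm_of_nonneg hac.le, Real.norm_of_nonneg hcb.le] at h
  exact h

end GaleDual
end CyclicPolytope

/-! ### Affine coordinates of points of hulls and of interior points. -/

namespace CyclicPolytope

open Finset

theorem mem_hull_iff {δ m : ℕ} {t : Fin m → ℝ} {A : Set (Fin m)} {x : Fin δ → ℝ} :
    x ∈ hull δ t A ↔ ∃ l : Fin m → ℝ, (∀ i, 0 ≤ l i) ∧ (∀ i, i ∉ A → l i = 0) ∧
      ∑ i, l i = 1 ∧ ∑ i, l i • momentCurve δ (t i) = x := by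
  classical
  constructor
  · intro hx
    refine convexHull_min (t := {x | ∃ l : Fin m → ℝ, (∀ i, 0 ≤ l i) ∧ (∀ i, i ∉ A → l i = 0) ∧
      ∑ i, l i = 1 ∧ ∑ i, l i • momentCurve δ (t i) = x}) ?_ ?_ hx
    · rintro _ ⟨a, ha, rfl⟩
      refine ⟨fun i => if i = a then 1 else 0, fun i => by dsimp only; split_ifs <;> norm_num,
        fun i hi => ?_, by simp, by simp⟩
      exact if_neg (by rintro rfl; exact hi ha)
    · rintro x ⟨l, h0, h1, h2, h3⟩ y ⟨l', h0', h1', h2', h3'⟩ a b ha hb hab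
      refine ⟨fun i => a * l i + b * l' i, fun i => ?_, fun i hi => ?_, ?_, ?_⟩
      · exact add_nonneg (mul_nonneg ha (h0 i)) (mul_nonneg hb (h0' i))
      · simp [h1 i hi, h1' i hi]
      · rw [sum_add_distrib, ← mul_sum, ← mul_sum, h2, h2', mul_one, mul_one, hab]
      · simp_rw [add_smul, sum_add_distrib, mul_smul, ← smul_sum, h3, h3']
  · rintro ⟨l, h0, h1, h2, h3⟩
    obtain ⟨a, ha⟩ : ∃ a, a ∈ A := by
      by_contra! h
      rw [sum_eq_zero fun i _ => h1 i (h i)] at h2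
      exact zero_ne_one h2
    refine mem_convexHull_of_exists_fintype l
      (fun i => if i ∈ A then momentCurve δ (t i) else momentCurve δ (t a)) h0 h2 (fun i => ?_) ?_
    · split_ifs with hi
      · exact ⟨i, hi, rfl⟩
      · exact ⟨a, ha, rfl⟩
    · rw [← h3]
      refine sum_congr rfl fun i _ => ?_
      split_ifs with hi
      · rfl
      · rw [h1 i hi, zero_smul, zero_smul]

theorem hull_mono {δ m : ℕ} (t : Fin m → ℝ) {A B : Set (Fin m)} (h : A ⊆ B) :
    hull δ t A ⊆ hull δ t B :=
  convexHull_mono (Set.image_mono h)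

theorem exists_pos_forall_add_mul_pos {ι : Type*} [Finite ι] {l e : ι → ℝ} (hl : ∀ i, 0 ≤ l i)
    (he : ∀ i, l i = 0 → 0 < e i) : ∃ ε > 0, ∀ i, 0 < l i + ε * e i := by
  have h : ∀ᶠ ε in nhdsWithin (0 : ℝ) (Set.Ioi 0), ∀ i, 0 < l i + ε * e i := by
    refine Filter.eventually_all.mpr fun i => ?_
    rcases (hl i).eq_or_lt with hi | hi
    · filter_upwards [self_mem_nhdsWithin] with ε hε
      rw [← hi, zero_add]
      exact mul_pos hε (he i hi.symm)
    · have : Filter.Tendsto (fun ε => l i + ε * e i) (nhds 0) (nhds (l i + 0 * e i)) :=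
        Continuous.tendsto (by fun_prop) _
      rw [zero_mul, add_zero] at this
      exact (this.eventually_const_lt hi).filter_mono nhdsWithin_le_nhds
  obtain ⟨ε, hε, hpos⟩ := (h.and self_mem_nhdsWithin).exists
  exact ⟨ε, hpos, hε⟩

theorem exists_pos_forall_add_mul_nonneg {ι : Type*} [Finite ι] {l e : ι → ℝ} (hl : ∀ i, 0 ≤ l i)
    (he : ∀ i, l i = 0 → 0 ≤ e i) : ∃ ε > 0, ∀ i, 0 ≤ l i + ε * e i := by
  have h : ∀ᶠ ε in nhdsWithin (0 : ℝ) (Set.Ioi 0), ∀ i, 0 ≤ l i + ε * e i := by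
    refine Filter.eventually_all.mpr fun i => ?_
    rcases (hl i).eq_or_lt with hi | hi
    · filter_upwards [self_mem_nhdsWithin] with ε hε
      rw [← hi, zero_add]
      exact mul_nonneg (le_of_lt hε) (he i hi.symm)
    · have : Filter.Tendsto (fun ε => l i + ε * e i) (nhds 0) (nhds (l i + 0 * e i)) :=
        Continuous.tendsto (by fun_prop) _
      rw [zero_mul, add_zero] at this
      exact (this.eventually_const_le hi).filter_mono nhdsWithin_le_nhds
  obtain ⟨ε, hε, hpos⟩ := (h.and self_mem_nhdsWithin).exists
  exact ⟨ε, hpos, hε⟩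

section Representations

variable {d : ℕ} {t : Fin (2 * d + 3) → ℝ}

/-- `l` are affine coordinates of the point `x` with respect to the points `p_{t i}`. -/
def IsRep (t : Fin (2 * d + 3) → ℝ) (l : Fin (2 * d + 3) → ℝ) (x : Fin (2 * d) → ℝ) : Prop :=
  ∑ i, l i = 1 ∧ ∑ i, l i • momentCurve (2 * d) (t i) = x

theorem IsRep.sub {l l' : Fin (2 * d + 3) → ℝ} {x : Fin (2 * d) → ℝ} (h : IsRep t l x)
    (h' : IsRep t l' x) : IsMomentDep d t (fun i => l i - l' i) :=
  isMomentDep_iff.mpr ⟨by rw [sum_sub_distrib, h.1, h'.1, sub_self],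
    by simp_rw [sub_smul, sum_sub_distrib, h.2, h'.2, sub_self]⟩

theorem IsRep.add_mul {l e : Fin (2 * d + 3) → ℝ} {x : Fin (2 * d) → ℝ} (h : IsRep t l x)
    (he : IsMomentDep d t e) (ε : ℝ) : IsRep t (fun i => l i + ε * e i) x := by
  obtain ⟨h0, h1⟩ := isMomentDep_iff.mp (he.smul ε)
  refine ⟨by rw [sum_add_distrib, h.1, h0, add_zero], ?_⟩
  simp_rw [add_smul, sum_add_distrib, h.2, h1, add_zero]

theorem mem_hull_iff_isRep {A : Set (Fin (2 * d + 3))} {x : Fin (2 * d) → ℝ} :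
    x ∈ hull (2 * d) t A ↔
      ∃ l : Fin (2 * d + 3) → ℝ, (∀ i, 0 ≤ l i) ∧ (∀ i, i ∉ A → l i = 0) ∧ IsRep t l x :=
  mem_hull_iff

theorem mem_polytope_iff {x : Fin (2 * d) → ℝ} :
    x ∈ polytope (2 * d) t ↔ ∃ l : Fin (2 * d + 3) → ℝ, (∀ i, 0 ≤ l i) ∧ IsRep t l x := by
  simp [polytope, mem_hull_iff_isRep]

theorem galeDet_ne_zero (ht : StrictMono t) {a b : Fin (2 * d + 3)} (h : a ≠ b) :
    galeDet t a b ≠ 0 := by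
  have hw : ∀ i, weight t i ≠ 0 := fun i hi => by simpa [hi] using weight_sign ht i
  exact mul_ne_zero (mul_ne_zero (hw a) (hw b)) (sub_ne_zero.mpr (ht.injective.ne h.symm))

/-- Omitting two points leaves `2d + 1` affinely independent ones, since a dependence that vanishes
at two indices is zero. -/
theorem affineSpan_momentCurve (ht : StrictMono t) :
    affineSpan ℝ ((fun i => momentCurve (2 * d) (t i)) '' Set.univ) = ⊤ := by
  classical
  let P : Fin (2 * d + 3) → Prop := fun i => i ≠ 0 ∧ i ≠ 1
  have h01 : (0 : Fin (2 * d + 3)) ≠ 1 := by simp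
  have hind : AffineIndependent ℝ (fun i : Subtype P => momentCurve (2 * d) (t i)) := by
    rw [affineIndependent_iff_of_fintype]
    intro w h0 h1 i
    rw [weightedVSub_eq_linear_combination _ h0] at h1
    set l : Fin (2 * d + 3) → ℝ := fun i => if h : P i then w ⟨i, h⟩ else 0 with hl
    have hlw : ∀ e : Subtype P, l e = w e := fun e => dif_pos e.2
    have hl0 : ∀ i, ¬ P i → l i = 0 := fun i hi => dif_neg hi
    have hP : ∀ i, i ∈ univ.filter P ↔ P i := fun i => by rw [mem_filter_univ]
    have hdep : IsMomentDep d t l := by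
      refine isMomentDep_iff.mpr ⟨?_, ?_⟩
      · rw [← h0, ← sum_congr rfl fun e _ => hlw e,
          ← sum_subtype (univ.filter P) hP l]
        exact (sum_subset (subset_univ _) fun i _ hi => hl0 i (mt (hP i).mpr hi)).symm
      · rw [← h1, ← sum_congr rfl fun (e : Subtype P) _ => congrArg (· • momentCurve (2 * d) (t e)) (hlw e),
          ← sum_subtype (univ.filter P) hP (fun i => l i • momentCurve (2 * d) (t i))]
        exact (sum_subset (subset_univ _) fun i _ hi => by
          rw [hl0 i (mt (hP i).mpr hi), zero_smul]).symm
    rw [← hlw i]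
    exact hdep.eq_zero ht (galeDet_ne_zero ht h01) (hl0 0 (by simp [P])) (hl0 1 (by simp [P])) i
  have hcard : Fintype.card (Subtype P) = Module.finrank ℝ (Fin (2 * d) → ℝ) + 1 := by
    rw [Fintype.card_subtype, Module.finrank_fin_fun]
    have : univ.filter P = ({0, 1} : Finset (Fin (2 * d + 3)))ᶜ := by ext i; simp [P]
    rw [this, card_compl, card_pair h01]; simp
  refine top_le_iff.mp ?_
  rw [← (hind.affineSpan_eq_top_iff_card_eq_finrank_add_one).mpr hcard]
  refine affineSpan_mono ℝ ?_
  rintro _ ⟨i, rfl⟩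
  exact ⟨i, trivial, rfl⟩

/-- With an interior point `z` at hand, positivity of the coordinates allows the segment from `z` to
`x` to be prolonged a little beyond `x` inside the polytope, so `x` is interior. -/
theorem mem_interior_polytope_of_pos (ht : StrictMono t) {l : Fin (2 * d + 3) → ℝ}
    (hl : ∀ i, 0 < l i) {x : Fin (2 * d) → ℝ} (hx : IsRep t l x) :
    x ∈ interior (polytope (2 * d) t) := by
  obtain ⟨z, hz⟩ := interior_convexHull_nonempty_iff_affineSpan_eq_top.mpr
    (affineSpan_momentCurve ht)
  change z ∈ interior (polytope (2 * d) t) at hz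
  obtain ⟨ν, hν, hzν⟩ := mem_polytope_iff.mp (interior_subset hz)
  obtain ⟨ε, hε, hpos⟩ := exists_pos_forall_add_mul_pos (l := l) (e := fun i => l i - ν i)
    (fun i => (hl i).le) fun i hi => absurd hi (hl i).ne'
  have hy : IsRep t (fun i => l i + ε * (l i - ν i)) (x + ε • (x - z)) := by
    refine ⟨?_, ?_⟩
    · rw [sum_add_distrib, ← mul_sum, sum_sub_distrib, hx.1, hzν.1]; ring
    · simp_rw [add_smul, mul_smul, sub_smul, sum_add_distrib, ← smul_sum, sum_sub_distrib,
        hx.2, hzν.2]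
  have hmem := mem_polytope_iff.mpr ⟨_, fun i => (hpos i).le, hy⟩
  have key := Convex.combo_interior_self_mem_interior (convex_convexHull ℝ _) hz hmem
    (a := ε / (1 + ε)) (b := 1 / (1 + ε)) (by positivity) (by positivity) (by field_simp; ring)
  suffices h : x = (ε / (1 + ε)) • z + (1 / (1 + ε)) • (x + ε • (x - z)) by rw [h]; exact key
  ext k
  simp only [Pi.add_apply, Pi.smul_apply, Pi.sub_apply, smul_eq_mul]
  field_simp
  ring

/-- Push `x` slightly away from the barycentre `q` of the points; `x` is then a convex combination
of the pushed point and `q`, and `q` contributes positively to each coordinate. -/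
theorem exists_pos_rep_of_mem_interior {x : Fin (2 * d) → ℝ}
    (hx : x ∈ interior (polytope (2 * d) t)) :
    ∃ l : Fin (2 * d + 3) → ℝ, (∀ i, 0 < l i) ∧ IsRep t l x := by
  set q : Fin (2 * d) → ℝ := ∑ i, ((2 * d + 3 : ℝ)⁻¹) • momentCurve (2 * d) (t i) with hq
  have hcont : Filter.Tendsto (fun ε : ℝ => x + ε • (x - q)) (nhds 0)
      (nhds (x + (0 : ℝ) • (x - q))) := Continuous.tendsto (by fun_prop) _
  rw [zero_smul, add_zero] at hcont
  have hev := (hcont.eventually (mem_interior_iff_mem_nhds.mp hx)).filter_mono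
    (nhdsWithin_le_nhds (s := Set.Ioi 0))
  obtain ⟨ε, hmem, hε⟩ := (hev.and self_mem_nhdsWithin).exists
  replace hε : 0 < ε := hε
  obtain ⟨ν, hν, h1, h2⟩ := mem_polytope_iff.mp hmem
  refine ⟨fun i => (1 + ε)⁻¹ * (ν i + ε * (2 * d + 3 : ℝ)⁻¹), fun i => ?_, ?_, ?_⟩
  · have := hν i
    positivity
  · rw [← mul_sum, sum_add_distrib, h1]
    simp only [sum_const, card_univ, Fintype.card_fin, nsmul_eq_mul]
    push_cast
    field_simp
  · simp_rw [mul_smul, add_smul, mul_smul, ← smul_sum, sum_add_distrib, ← smul_sum, h2]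
    rw [smul_sum, ← hq]
    ext k
    simp only [Pi.add_apply, Pi.smul_apply, Pi.sub_apply, smul_eq_mul]
    field_simp
    ring

end Representations
end CyclicPolytope

namespace CyclicPolytope

open Finset

/-! ### Arcs of rays and the internal simplices. -/

section Rays

variable {d : ℕ} {t : Fin (2 * d + 3) → ℝ}

theorem exists_eq_add_natCast {n : ℕ} [NeZero n] (j v : ZMod n) :
    ∃ m < n, v = j + (m : ZMod n) :=
  ⟨(v - j).val, ZMod.val_lt _, by simp⟩

theorem add_natCast_sub_val {n : ℕ} (j : ZMod n) {m : ℕ} (hm : m < n) :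
    (j + (m : ZMod n) - j).val = m := by
  rw [add_sub_cancel_left, ZMod.val_cast_of_lt hm]

theorem add_natCast_eq_of_add_eq {n : ℕ} {j x : ZMod n} {m q : ℕ} (hx : x = j + (m : ZMod n))
    (h : m + q = n) : j = x + (q : ZMod n) := by
  rw [hx, add_assoc, ← Nat.cast_add, h, ZMod.natCast_self, add_zero]

theorem galeDet_ray_nonneg (ht : StrictMono t) (k : ZMod (2 * d + 3)) {j : ℕ} (h : j ≤ d + 1) :
    0 ≤ galeDet t (ray d k) (ray d (k + j)) := by
  rcases Nat.eq_zero_or_pos j with rfl | hj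
  · simp [galeDet_self]
  · exact (galeDet_ray_pos ht k hj h).le

/-- A dependence which is nonpositive on the two ends of a short arc of rays is nonpositive on the
whole arc. -/
theorem IsMomentDep.nonpos_of_nonpos (ht : StrictMono t) {e : Fin (2 * d + 3) → ℝ}
    (he : IsMomentDep d t e) {r : ZMod (2 * d + 3)} {s q : ℕ} (hs1 : 1 ≤ s) (hs : s ≤ d + 1)
    (hq : q ≤ s) (h0 : e (ray d r) ≤ 0) (h1 : e (ray d (r + s)) ≤ 0) :
    e (ray d (r + q)) ≤ 0 := by
  have h3 := he.three_term ht (ray d r) (ray d (r + s)) (ray d (r + q))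
  have p1 := galeDet_ray_pos ht r hs1 hs
  have p2 := galeDet_ray_nonneg ht r (hq.trans hs)
  have p3 := galeDet_ray_nonneg ht (r + q) (j := s - q) (by omega)
  rw [add_assoc, ← Nat.cast_add, Nat.add_sub_cancel' hq] at p3
  rw [galeDet_swap (ray d (r + q)), galeDet_swap (ray d r) (ray d (r + q))] at h3
  by_contra! hpos
  nlinarith [mul_pos p1 hpos, mul_nonneg p3 (neg_nonneg.mpr h0),
    mul_nonneg p2 (neg_nonneg.mpr h1)]

/-- The arc of `d + 2` consecutive rays which starts at `j`. -/
def rayArc (d : ℕ) (j : ZMod (2 * d + 3)) : Finset (Fin (2 * d + 3)) :=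
  (range (d + 2)).image fun m : ℕ => ray d (j + m)

theorem ray_add_mem_rayArc {j : ZMod (2 * d + 3)} {m : ℕ} (hm : m ≤ d + 1) :
    ray d (j + m) ∈ rayArc d j :=
  mem_image.mpr ⟨m, mem_range.mpr (by omega), rfl⟩

theorem ray_mem_rayArc_iff {j v : ZMod (2 * d + 3)} :
    ray d v ∈ rayArc d j ↔ (v - j).val ≤ d + 1 := by
  constructor
  · intro h
    obtain ⟨m, hm, h⟩ := mem_image.mp h
    rw [← (ray d).injective h]
    have := mem_range.mp hm
    rw [add_natCast_sub_val _ (by omega)]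
    omega
  · intro h
    have := ray_add_mem_rayArc (j := j) h
    simpa using this

theorem card_rayArc (j : ZMod (2 * d + 3)) : (rayArc d j).card = d + 2 := by
  rw [rayArc, card_image_of_injOn, card_range]
  intro a ha b hb hab
  have ha := mem_range.mp ha
  have hb := mem_range.mp hb
  have := congrArg (fun v => (v - j).val) ((ray d).injective hab)
  simpa only [add_natCast_sub_val j (show a < 2 * d + 3 by omega),
    add_natCast_sub_val j (show b < 2 * d + 3 by omega)] using this

theorem rayArc_injective : Function.Injective (rayArc d) := by
  intro a b hab
  by_contra hne
  have h1 : (a - b).val ≤ d + 1 := by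
    rw [← ray_mem_rayArc_iff, ← hab, ray_mem_rayArc_iff]; simp
  have h2 : (b - a).val ≤ d + 1 := by
    rw [← ray_mem_rayArc_iff, hab, ray_mem_rayArc_iff]; simp
  have h3 : (b - a).val = 2 * d + 3 - (a - b).val := by
    have : NeZero (a - b) := ⟨sub_ne_zero.mpr hne⟩
    rw [← neg_sub, ZMod.val_neg_of_ne_zero]
  omega

/-- The rays on which a dependence is positive lie on an arc of length `d + 2`. -/
theorem IsMomentDep.exists_pos_subset_rayArc (ht : StrictMono t) {e : Fin (2 * d + 3) → ℝ}
    (he : IsMomentDep d t e) : ∃ j, ∀ i, 0 < e i → i ∈ rayArc d j := by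
  by_cases hne : ∃ v, 0 < e (ray d v)
  swap
  · push Not at hne
    exact ⟨0, fun i hi => absurd hi (not_lt.mpr (by simpa using hne ((ray d).symm i)))⟩
  obtain ⟨j, hj, hj'⟩ : ∃ j, 0 < e (ray d j) ∧ e (ray d (j - 1)) ≤ 0 := by
    by_contra! hall
    obtain ⟨v, hv⟩ := hne
    have hpos : ∀ m : ℕ, 0 < e (ray d (v - m)) := by
      intro m
      induction m with
      | zero => simpa using hv
      | succ m ih => simpa [sub_sub] using hall _ ih
    have hpos' : ∀ u, 0 < e (ray d u) := fun u => by
      simpa using hpos (v - u).val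
    -- These three rays surround the origin, so the relation has positive coefficients and the three
    -- values cannot all be positive.
    have h3 := he.three_term ht (ray d 0) (ray d (0 + (d + 1 : ℕ)))
      (ray d (0 + (d + 1 : ℕ) + (1 : ℕ)))
    have p1 := galeDet_ray_pos ht 0 (j := d + 1) (by omega) le_rfl
    have p2 := galeDet_ray_pos ht (0 + (d + 1 : ℕ)) (j := 1) le_rfl (by omega)
    have p3 := galeDet_ray_pos ht (0 + (d + 1 : ℕ) + (1 : ℕ)) (j := d + 1) (by omega) le_rfl
    rw [show (0 + ((d + 1 : ℕ) : ZMod (2 * d + 3)) + (1 : ℕ) + (d + 1 : ℕ)) = 0 by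
      rw [zero_add, ← Nat.cast_add, ← Nat.cast_add, show d + 1 + 1 + (d + 1) = 2 * d + 3 by ring,
        ZMod.natCast_self]] at p3
    linarith [mul_pos p1 (hpos' (0 + (d + 1 : ℕ) + (1 : ℕ))), mul_pos p2 (hpos' 0),
      mul_pos p3 (hpos' (0 + (d + 1 : ℕ)))]
  refine ⟨j, fun i hi => ?_⟩
  obtain ⟨x, rfl⟩ := (ray d).surjective i
  rw [ray_mem_rayArc_iff]
  by_contra! hlt
  obtain ⟨m, hm, hx⟩ := exists_eq_add_natCast j x
  rw [hx, add_natCast_sub_val _ hm] at hlt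
  have hjx : j = x + ((2 * d + 3 - m : ℕ) : ZMod (2 * d + 3)) :=
    add_natCast_eq_of_add_eq hx (by omega)
  have hjx' : j - 1 = x + ((2 * d + 2 - m : ℕ) : ZMod (2 * d + 3)) := by
    rw [hjx, show 2 * d + 3 - m = 2 * d + 2 - m + 1 by omega]; push_cast; ring
  -- Outside the arc, `x` precedes `j` by at most `d + 1` steps, with `j - 1` between them.
  -- Positivity at `x` and at `j` would force positivity at `j - 1`.
  have h3 := he.three_term ht (ray d x) (ray d j) (ray d (j - 1))
  have p1 := galeDet_ray_pos ht x (j := 2 * d + 3 - m) (by omega) (by omega)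
  have p2 := galeDet_ray_nonneg ht x (j := 2 * d + 2 - m) (by omega)
  have p3 := galeDet_ray_pos ht (j - 1) (j := 1) le_rfl (by omega)
  rw [← hjx] at p1
  rw [← hjx'] at p2
  rw [Nat.cast_one, sub_add_cancel] at p3
  rw [galeDet_swap (ray d (j - 1)) (ray d j), galeDet_swap (ray d x) (ray d (j - 1))] at h3
  nlinarith [mul_pos p3 hi, mul_nonneg p1.le (neg_nonneg.mpr hj'), mul_nonneg p2 hj.le]

/-- The complement of an arc of `d + 2` rays. -/
def arcSimplex (d : ℕ) (j : ZMod (2 * d + 3)) : Finset (Fin (2 * d + 3)) := (rayArc d j)ᶜ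

theorem card_arcSimplex (j : ZMod (2 * d + 3)) : (arcSimplex d j).card = d + 1 := by
  rw [arcSimplex, card_compl, card_rayArc, Fintype.card_fin]; omega

/-- The barycentre of the simplex is interior: some dependence is positive on the whole omitted arc,
and a small multiple of it makes all coordinates positive. -/
theorem isInternal_arcSimplex (ht : StrictMono t) (j : ZMod (2 * d + 3)) :
    IsInternal d t (arcSimplex d j) := by
  refine ⟨card_arcSimplex j, fun hsub => ?_⟩
  set l : Fin (2 * d + 3) → ℝ := fun i => if i ∈ arcSimplex d j then (d + 1 : ℝ)⁻¹ else 0 with hl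
  have hl0 : ∀ i, 0 ≤ l i := fun i => by
    simp only [hl]; split_ifs <;> positivity
  have hrep : IsRep t l (∑ i, l i • momentCurve (2 * d) (t i)) := by
    refine ⟨?_, rfl⟩
    simp only [hl, sum_ite_mem, univ_inter, sum_const, card_arcSimplex, nsmul_eq_mul]
    push_cast
    field_simp
  have hmem : ∑ i, l i • momentCurve (2 * d) (t i) ∈
      hull (2 * d) t (arcSimplex d j : Set (Fin (2 * d + 3))) :=
    mem_hull_iff_isRep.mpr ⟨l, hl0, fun i hi => if_neg (by simpa using hi), hrep⟩
  -- Each summand is nonnegative on the arc. The first vanishes there only at the initial ray and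
  -- the second only at the final one.
  have hdep := (isMomentDep_galeDet_left ht (ray d j)).add
    (isMomentDep_galeDet_right ht (ray d (j + (d + 1 : ℕ))))
  have hpos : ∀ i, l i = 0 → 0 < galeDet t (ray d j) i + galeDet t i (ray d (j + (d + 1 : ℕ))) := by
    intro i hi
    have hi' : i ∈ rayArc d j := by
      by_contra h
      have : l i = (d + 1 : ℝ)⁻¹ := if_pos (by simpa [arcSimplex] using h)
      rw [this] at hi
      exact (show (0 : ℝ) < (d + 1 : ℝ)⁻¹ by positivity).ne' hi
    obtain ⟨m, hm, rfl⟩ := mem_image.mp hi'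
    have hm := mem_range.mp hm
    have p1 := galeDet_ray_nonneg ht j (j := m) (by omega)
    have p2 := galeDet_ray_nonneg ht (j + m) (j := d + 1 - m) (by omega)
    have hadd : j + (m : ZMod (2 * d + 3)) + ((d + 1 - m : ℕ) : ZMod (2 * d + 3)) =
        j + (d + 1 : ℕ) := by
      rw [add_assoc, ← Nat.cast_add, Nat.add_sub_cancel' (by omega)]
    rw [hadd] at p2
    rcases Nat.eq_zero_or_pos m with rfl | h0
    · have p3 := galeDet_ray_pos ht (j + (0 : ℕ)) (j := d + 1 - 0) (by omega) (by omega)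
      rw [hadd] at p3
      linarith
    · have p3 := galeDet_ray_pos ht j h0 (by omega)
      linarith
  obtain ⟨ε, -, hε⟩ := exists_pos_forall_add_mul_pos hl0 hpos
  exact (disjoint_interior_frontier.le_bot
    ⟨mem_interior_polytope_of_pos ht hε (hrep.add_mul hdep ε), hsub hmem⟩)

/-- An interior point of the simplex has positive coordinates and also coordinates supported on `A`.
Their difference is positive off `A`, so the complement of `A` lies in an arc, and equals it by
cardinality. -/
theorem IsInternal.exists_eq_arcSimplex (ht : StrictMono t) {A : Finset (Fin (2 * d + 3))}
    (hA : IsInternal d t A) : ∃ j, A = arcSimplex d j := by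
  obtain ⟨hcard, hnot⟩ := hA
  obtain ⟨y, hy, hyf⟩ := Set.not_subset.mp hnot
  have hyi : y ∈ interior (polytope (2 * d) t) := by
    by_contra h
    exact hyf ⟨subset_closure (hull_mono t (Set.subset_univ _) hy), h⟩
  obtain ⟨l, hl, hly⟩ := exists_pos_rep_of_mem_interior hyi
  obtain ⟨l', -, hl', hly'⟩ := mem_hull_iff_isRep.mp hy
  obtain ⟨j, hj⟩ := (hly.sub hly').exists_pos_subset_rayArc ht
  have hsub : Aᶜ ⊆ rayArc d j := fun i hi => hj i (by
    rw [hl' i (by simpa using hi), sub_zero]; exact hl i)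
  have heq := eq_of_subset_of_card_le hsub (by
    rw [card_rayArc, card_compl, hcard, Fintype.card_fin]; omega)
  exact ⟨j, by rw [arcSimplex, ← heq, compl_compl]⟩

end Rays
end CyclicPolytope

namespace CyclicPolytope

open Finset

/-! ### Triangulations and chambers of the Gale dual. -/

section Triangulations

variable {d : ℕ} {t : Fin (2 * d + 3) → ℝ}

/-- The simplices whose complementary pair of rays spans a cone containing the chamber between the
rays `k` and `k + 1`. -/
def chamberTriangulation (d : ℕ) (k : ZMod (2 * d + 3)) : Set (Finset (Fin (2 * d + 3))) :=
  {S | ∃ (r : ZMod (2 * d + 3)) (i j : ℕ), i + j ≤ d ∧ k = r + i ∧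
    S = {ray d r, ray d (r + (i + j + 1 : ℕ))}ᶜ}

theorem galeDet_ne {a b : Fin (2 * d + 3)} (h : 0 < galeDet t a b) : a ≠ b := by
  rintro rfl
  rw [galeDet_self] at h
  exact lt_irrefl _ h

/-- Linear programming: among the nonnegative coordinates of `x`, minimise the sum of those at `k`
and `k + 1`. At a minimum the vanishing coordinates include two rays whose cone contains the
chamber. -/
theorem chamberTriangulation_cover (ht : StrictMono t) (k : ZMod (2 * d + 3)) :
    polytope (2 * d) t ⊆
      ⋃ S ∈ chamberTriangulation d k, hull (2 * d) t (S : Set (Fin (2 * d + 3))) := by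
  intro x hx
  set R : Set (Fin (2 * d + 3) → ℝ) := {l | (∀ i, 0 ≤ l i) ∧ IsRep t l x} with hR
  have hRne : R.Nonempty := mem_polytope_iff.mp hx
  have hRcpt : IsCompact R := by
    have : R = stdSimplex ℝ (Fin (2 * d + 3)) ∩
        {l | ∑ i, l i • momentCurve (2 * d) (t i) = x} := by
      ext l
      simp only [hR, IsRep, stdSimplex, Set.mem_ofPred_eq, Set.mem_inter_iff, and_assoc]
    rw [this]
    exact (isCompact_stdSimplex ℝ _).inter_right (isClosed_eq (by fun_prop) continuous_const)
  obtain ⟨l, ⟨hl0, hlx⟩, hmin⟩ := hRcpt.exists_isMinOn hRne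
    (f := fun l => l (ray d k) + l (ray d (k + 1))) (by fun_prop)
  -- First-order optimality: no feasible direction decreases the objective.
  have himp : ∀ e, IsMomentDep d t e → (∀ i, l i = 0 → 0 ≤ e i) →
      0 ≤ e (ray d k) + e (ray d (k + 1)) := by
    intro e he hnn
    obtain ⟨ε, hε, hpos⟩ := exists_pos_forall_add_mul_nonneg hl0 hnn
    have := hmin (show (fun i => l i + ε * e i) ∈ R from ⟨hpos, hlx.add_mul he ε⟩)
    simp only [Set.mem_ofPred_eq] at this
    have h2 : 0 ≤ ε * (e (ray d k) + e (ray d (k + 1))) := by linarith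
    exact nonneg_of_mul_nonneg_right h2 hε
  have hmain : ∃ (r : ZMod (2 * d + 3)) (i j : ℕ), i + j ≤ d ∧ k = r + i ∧
      l (ray d r) = 0 ∧ l (ray d (r + (i + j + 1 : ℕ))) = 0 := by
    classical
    by_cases hex : ∃ i : ℕ, i ≤ d ∧ l (ray d (k - i)) = 0
    · obtain ⟨hid, hi0⟩ := Nat.find_spec hex
      have himin := fun m (hm : m < Nat.find hex) => Nat.find_min hex hm
      set i := Nat.find hex
      set r := k - (i : ZMod (2 * d + 3)) with hr
      have hk : k = r + i := by rw [hr]; ring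
      by_contra! hno
      -- Here `r` is the last vanishing ray at or before `k`. If none vanished from `k + 1` to `r +
      -- d + 1`, this direction would be feasible and would decrease the objective.
      have key := himp _ (isMomentDep_galeDet_right ht (ray d r)) ?_
      · have p1 := galeDet_ray_nonneg ht r (j := i) (by omega)
        have p2 := galeDet_ray_pos ht r (j := i + 1) (by omega) (by omega)
        have hk1 : k + 1 = r + (i + 1 : ℕ) := by rw [hk]; push_cast; ring
        rw [← hk] at p1
        rw [← hk1] at p2
        rw [galeDet_swap (ray d r) (ray d k), galeDet_swap (ray d r) (ray d (k + 1))] at key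
        linarith
      · intro z hz
        obtain ⟨y, rfl⟩ := (ray d).surjective z
        obtain ⟨m, hm, hy⟩ := exists_eq_add_natCast r y
        by_cases hmd : m ≤ d + 1
        · rcases Nat.lt_or_ge i m with him | him
          · refine absurd ?_ (hno r i (m - i - 1) (by omega) hk hi0)
            rw [show i + (m - i - 1) + 1 = m by omega, ← hy, hz]
          · rcases Nat.eq_zero_or_pos m with rfl | hm0
            · simp [hy, galeDet_self]
            · refine absurd ⟨by omega, ?_⟩ (himin (i - m) (by omega))
              rw [← hz, hy, hr, Nat.cast_sub him]
              congr 2; ring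
        · have hq := add_natCast_eq_of_add_eq hy (show m + (2 * d + 3 - m) = 2 * d + 3 by omega)
          have := galeDet_ray_nonneg ht y (j := 2 * d + 3 - m) (by omega)
          rwa [← hq] at this
    · exfalso
      push Not at hex
      -- With no vanishing ray from `k - d` to `k`, this direction is feasible, zero at `k + 1` and
      -- negative at `k`.
      have key := himp _ (isMomentDep_galeDet_left ht (ray d (k + 1))) ?_
      · have p1 := galeDet_ray_pos ht k (j := 1) le_rfl (by omega)
        rw [galeDet_self, galeDet_swap (ray d k)] at key
        push_cast at p1
        linarith
      · intro z hz
        obtain ⟨y, rfl⟩ := (ray d).surjective z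
        obtain ⟨m, hm, hy⟩ := exists_eq_add_natCast (k + 1) y
        by_cases hmd : m ≤ d + 1
        · rw [hy]
          exact galeDet_ray_nonneg ht (k + 1) hmd
        · refine absurd hz ?_
          have hq := add_natCast_eq_of_add_eq hy (show m + (2 * d + 3 - m) = 2 * d + 3 by omega)
          have hy' : y = k - ((2 * d + 2 - m : ℕ) : ZMod (2 * d + 3)) := by
            rw [show 2 * d + 3 - m = 2 * d + 2 - m + 1 by omega] at hq
            push_cast at hq
            linear_combination -hq
          rw [hy']
          exact hex _ (by omega)
  obtain ⟨r, i, j, hij, hk, h0, h1⟩ := hmain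
  refine Set.mem_iUnion₂.mpr ⟨_, ⟨r, i, j, hij, hk, rfl⟩, mem_hull_iff_isRep.mpr
    ⟨l, hl0, fun z hz => ?_, hlx⟩⟩
  simp only [coe_compl, Set.mem_compl_iff, not_not, coe_insert, coe_singleton,
    Set.mem_insert_iff, Set.mem_singleton_iff] at hz
  rcases hz with rfl | rfl
  · exact h0
  · exact h1

/-- Coordinates supported on a simplex of the chamber triangulation are minimal at `k` and `k + 1`.
Applied in both directions to a point of two simplices, this makes its two coordinate vectors equal.
-/
theorem nonpos_of_rep_of_rep (ht : StrictMono t) {k : ZMod (2 * d + 3)}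
    {S : Finset (Fin (2 * d + 3))} (hS : S ∈ chamberTriangulation d k)
    {l l' : Fin (2 * d + 3) → ℝ} (h : IsMomentDep d t (fun i => l i - l' i))
    (hl : ∀ i ∉ S, l i = 0) (hl' : ∀ i, 0 ≤ l' i) :
    l (ray d k) - l' (ray d k) ≤ 0 ∧ l (ray d (k + 1)) - l' (ray d (k + 1)) ≤ 0 := by
  obtain ⟨r, i, j, hij, hk, rfl⟩ := hS
  have h0 : l (ray d r) - l' (ray d r) ≤ 0 := by
    rw [hl _ (by simp)]; linarith [hl' (ray d r)]
  have h1 : l (ray d (r + (i + j + 1 : ℕ))) - l' (ray d (r + (i + j + 1 : ℕ))) ≤ 0 := by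
    rw [hl _ (by simp)]; linarith [hl' (ray d (r + (i + j + 1 : ℕ)))]
  have hk1 : k + 1 = r + (i + 1 : ℕ) := by rw [hk]; push_cast; ring
  rw [hk1, hk]
  exact ⟨h.nonpos_of_nonpos ht (by omega) (by omega) (by omega) h0 h1,
    h.nonpos_of_nonpos ht (by omega) (by omega) (by omega) h0 h1⟩

theorem isTriangulation_chamberTriangulation (ht : StrictMono t) (k : ZMod (2 * d + 3)) :
    IsTriangulation (2 * d) t (chamberTriangulation d k) where
  card_eq := by
    rintro S ⟨r, i, j, hij, -, rfl⟩
    have hne := galeDet_ne (galeDet_ray_pos ht r (j := i + j + 1) (by omega) (by omega))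
    rw [card_compl, card_pair hne, Fintype.card_fin]; omega
  cover := by
    refine Set.Subset.antisymm ?_ (chamberTriangulation_cover ht k)
    exact Set.iUnion₂_subset fun S _ => hull_mono t (Set.subset_univ _)
  inter := by
    intro S hS S' hS'
    refine Set.Subset.antisymm ?_ (Set.subset_inter (hull_mono t Set.inter_subset_left)
      (hull_mono t Set.inter_subset_right))
    rintro x ⟨hx, hx'⟩
    obtain ⟨l, hl0, hl, hlx⟩ := mem_hull_iff_isRep.mp hx
    obtain ⟨l', hl0', hl', hlx'⟩ := mem_hull_iff_isRep.mp hx'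
    have hdep := hlx.sub hlx'
    obtain ⟨a1, a2⟩ := nonpos_of_rep_of_rep ht hS hdep (by simpa using hl) hl0'
    obtain ⟨b1, b2⟩ := nonpos_of_rep_of_rep ht hS' (hlx'.sub hlx) (by simpa using hl') hl0
    have hpos := galeDet_ray_pos ht k (j := 1) le_rfl (by omega)
    rw [Nat.cast_one] at hpos
    have heq : ∀ i, l i = l' i := fun i =>
      sub_eq_zero.mp (hdep.eq_zero ht hpos.ne' (by linarith) (by linarith) i)
    refine mem_hull_iff_isRep.mpr ⟨l, hl0, fun i hi => ?_, hlx⟩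
    by_cases hiS : i ∈ (S : Set (Fin (2 * d + 3)))
    · rw [heq]
      exact hl' i fun h => hi ⟨hiS, h⟩
    · exact hl i hiS

/-- Every triangulation contains a simplex whose two missing rays are adjacent. -/
theorem IsTriangulation.exists_chamber_mem (ht : StrictMono t)
    {T : Set (Finset (Fin (2 * d + 3)))} (hT : IsTriangulation (2 * d) t T) :
    ∃ k, ({ray d k, ray d (k + 1)}ᶜ : Finset (Fin (2 * d + 3))) ∈ T := by
  set M := ∑ i, galeNorm t i with hM
  have hMpos : 0 < M := sum_pos (fun i _ => galeNorm_pos ht i) univ_nonempty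
  -- Coordinates proportional to a strictly convex function of the Gale vectors. Eliminating two
  -- non-adjacent rays makes a coordinate strictly between them negative, so any simplex containing
  -- `x` omits adjacent rays.
  set l : Fin (2 * d + 3) → ℝ := fun i => galeNorm t i / M with hl
  set x := ∑ i, l i • momentCurve (2 * d) (t i) with hx
  have hlx : IsRep t l x := ⟨by rw [← sum_div, div_self hMpos.ne'], rfl⟩
  have hxp : x ∈ polytope (2 * d) t :=
    mem_polytope_iff.mpr ⟨l, fun i => (div_pos (galeNorm_pos ht i) hMpos).le, hlx⟩
  rw [← hT.cover] at hxp
  obtain ⟨S, hS, hxS⟩ := Set.mem_iUnion₂.mp hxp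
  obtain ⟨ν, hν0, hνS, hνx⟩ := mem_hull_iff_isRep.mp hxS
  have hcard : (Sᶜ).card = 2 := by
    rw [card_compl, hT.card_eq S hS, Fintype.card_fin]; omega
  have hpair : ∃ (u : ZMod (2 * d + 3)) (s : ℕ), 1 ≤ s ∧ s ≤ d + 1 ∧
      Sᶜ = {ray d u, ray d (u + s)} := by
    obtain ⟨a, b, hab, habS⟩ := card_eq_two.mp hcard
    obtain ⟨u, rfl⟩ := (ray d).surjective a
    obtain ⟨v, rfl⟩ := (ray d).surjective b
    obtain ⟨s, hs, rfl⟩ := exists_eq_add_natCast u v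
    have hs0 : s ≠ 0 := by rintro rfl; simp at hab
    by_cases hsd : s ≤ d + 1
    · exact ⟨u, s, by omega, hsd, habS⟩
    · have hq := add_natCast_eq_of_add_eq (rfl : u + (s : ZMod (2 * d + 3)) = u + s)
        (show s + (2 * d + 3 - s) = 2 * d + 3 by omega)
      exact ⟨u + s, 2 * d + 3 - s, by omega, by omega, by rw [← hq, habS, pair_comm]⟩
  obtain ⟨u, s, hs1, hsd, hSc⟩ := hpair
  rcases hs1.eq_or_lt with rfl | hs2
  · refine ⟨u, ?_⟩
    rw [Nat.cast_one] at hSc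
    rwa [← hSc, compl_compl]
  exfalso
  have p1 := galeDet_ray_pos ht u hs1 hsd
  have p2 := galeDet_ray_pos ht u (j := 1) le_rfl (by omega)
  have p3 := galeDet_ray_pos ht (u + (1 : ℕ)) (j := s - 1) (by omega) (by omega)
  rw [add_assoc, ← Nat.cast_add, Nat.add_sub_cancel' hs1] at p3
  have hlt := galeNorm_lt p1 p2 p3
  have h3 := (hνx.sub hlx).three_term ht (ray d u) (ray d (u + s)) (ray d (u + (1 : ℕ)))
  have e1 : ν (ray d u) = 0 := hνS _ (by
    have : ray d u ∈ Sᶜ := by rw [hSc]; simp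
    simpa using this)
  have e2 : ν (ray d (u + s)) = 0 := hνS _ (by
    have : ray d (u + s) ∈ Sᶜ := by rw [hSc]; simp
    simpa using this)
  have e3 := hν0 (ray d (u + (1 : ℕ)))
  rw [galeDet_swap (ray d (u + (1 : ℕ))) (ray d (u + s)),
    galeDet_swap (ray d u) (ray d (u + (1 : ℕ))), e1, e2] at h3
  have hlM : ∀ i, galeNorm t i = M * l i := fun i => by rw [hl]; field_simp
  rw [hlM, hlM (ray d u), hlM (ray d (u + s))] at hlt
  have h4 : 0 ≤ M * (galeDet t (ray d u) (ray d (u + s)) * ν (ray d (u + (1 : ℕ)))) := by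
    positivity
  have h5 := congrArg (M * ·) h3
  simp only [mul_zero] at h5
  linarith

/-- A dependence separating the chamber of one simplex of a triangulation from the complement of
another simplex vanishes. -/
theorem IsTriangulation.dep_eq_zero (ht : StrictMono t)
    {T : Set (Finset (Fin (2 * d + 3)))} (hT : IsTriangulation (2 * d) t T)
    {S S' : Finset (Fin (2 * d + 3))} (hS : S ∈ T) (hS' : S' ∈ T) {e : Fin (2 * d + 3) → ℝ}
    (he : IsMomentDep d t e) (h : ∀ i ∉ S, e i ≤ 0) (h' : ∀ i ∉ S', 0 ≤ e i) (i : Fin (2 * d + 3)) :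
    e i = 0 := by
  have hunique : ∀ {S : Finset (Fin (2 * d + 3))}, S ∈ T → ∀ {e : Fin (2 * d + 3) → ℝ},
      IsMomentDep d t e → (∀ i ∉ S, e i = 0) → ∀ i, e i = 0 := by
    intro S hS e he h0
    have hcard : (Sᶜ).card = 2 := by
      rw [card_compl, hT.card_eq S hS, Fintype.card_fin]; omega
    obtain ⟨a, b, hab, habS⟩ := card_eq_two.mp hcard
    have ha : a ∉ S := by rw [← mem_compl, habS]; simp
    have hb : b ∉ S := by rw [← mem_compl, habS]; simp
    exact he.eq_zero ht (galeDet_ne_zero ht hab) (h0 a ha) (h0 b hb)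
  obtain ⟨hsum, hvec⟩ := isMomentDep_iff.mp he
  set s := ∑ i, (e i)⁺ with hs
  have hs' : ∑ i, (e i)⁻ = s := by
    rw [← sub_eq_zero, hs, ← neg_sub, ← sum_sub_distrib]
    simp_rw [posPart_sub_negPart, hsum, neg_zero]
  have hs0 : 0 ≤ s := sum_nonneg fun i _ => posPart_nonneg _
  rcases hs0.eq_or_lt with hz | hpos
  · have h1 := (sum_eq_zero_iff_of_nonneg fun i _ => posPart_nonneg (e i)).mp (hs.symm.trans hz.symm)
    have h2 := (sum_eq_zero_iff_of_nonneg fun i _ => negPart_nonneg (e i)).mp (hs'.trans hz.symm)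
    rw [← posPart_sub_negPart (e i), h1 i (mem_univ _), h2 i (mem_univ _), sub_zero]
  -- The normalised positive and negative parts of `e` represent one point `y`, which lies in both
  -- simplices and hence in their common face. Uniqueness of coordinates on `S` then puts the
  -- positive part on that face.
  set y := ∑ i, ((e i)⁺ / s) • momentCurve (2 * d) (t i) with hy
  have hrep : IsRep t (fun i => (e i)⁺ / s) y := ⟨by rw [← sum_div, ← hs, div_self hpos.ne'], rfl⟩
  have hrep' : IsRep t (fun i => (e i)⁻ / s) y := by
    have := hrep.add_mul he (-s⁻¹)
    convert this using 2 with i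
    rw [← posPart_sub_negPart (e i)]
    simp only [posPart_sub_negPart]
    rw [show (e i)⁻ = (e i)⁺ - e i by linarith [posPart_sub_negPart (e i)]]
    ring
  have hyS : y ∈ hull (2 * d) t (S : Set (Fin (2 * d + 3))) :=
    mem_hull_iff_isRep.mpr ⟨_, fun i => div_nonneg (posPart_nonneg _) hpos.le, fun i hi => by
      rw [posPart_eq_zero.mpr (h i (by simpa using hi)), zero_div], hrep⟩
  have hyS' : y ∈ hull (2 * d) t (S' : Set (Fin (2 * d + 3))) :=
    mem_hull_iff_isRep.mpr ⟨_, fun i => div_nonneg (negPart_nonneg _) hpos.le, fun i hi => by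
      rw [negPart_eq_zero.mpr (h' i (by simpa using hi)), zero_div], hrep'⟩
  have hmem : y ∈ hull (2 * d) t (S : Set (Fin (2 * d + 3))) ∩
      hull (2 * d) t (S' : Set (Fin (2 * d + 3))) := ⟨hyS, hyS'⟩
  rw [hT.inter S hS S' hS'] at hmem
  obtain ⟨μ, -, hμ, hμy⟩ := mem_hull_iff_isRep.mp hmem
  have heq := hunique hS (hrep.sub hμy) fun i hi => by
    rw [posPart_eq_zero.mpr (h i hi), hμ i fun hi' => hi (by simpa using hi'.1)]; simp
  refine hunique hS' he (fun i hi => ?_) i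
  have h1 : (e i)⁺ / s = 0 := by
    have := heq i
    rwa [hμ i fun hi' => hi (by simpa using hi'.2), sub_zero] at this
  have h2 : (e i)⁺ = 0 := by simpa [hpos.ne'] using h1
  exact le_antisymm (posPart_eq_zero.mp h2) (h' i hi)

/-- Otherwise the omitted arc, which contains the rays omitted by `S`, is separated from the chamber
by a line through an end of the arc, against `dep_eq_zero`. -/
theorem IsTriangulation.val_sub_le (ht : StrictMono t)
    {T : Set (Finset (Fin (2 * d + 3)))} (hT : IsTriangulation (2 * d) t T)
    {k : ZMod (2 * d + 3)} (hk : ({ray d k, ray d (k + 1)}ᶜ : Finset (Fin (2 * d + 3))) ∈ T)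
    {S : Finset (Fin (2 * d + 3))} (hS : S ∈ T) {j : ZMod (2 * d + 3)}
    (hj : arcSimplex d j ⊆ S) : (k - j).val ≤ d := by
  by_contra! hlt
  have hmem : ∀ i ∉ S, i ∈ rayArc d j := fun i hi => by
    by_contra h
    exact hi (hj (by simpa [arcSimplex] using h))
  obtain ⟨m, hm, hkm⟩ := exists_eq_add_natCast j k
  rw [hkm, add_natCast_sub_val _ hm] at hlt
  by_cases hm2 : m = 2 * d + 2
  · have hjk : k + 1 = j := by
      have := add_natCast_eq_of_add_eq hkm (show m + 1 = 2 * d + 3 by omega)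
      rw [Nat.cast_one] at this
      exact this.symm
    have hz := hT.dep_eq_zero ht hk hS (isMomentDep_galeDet_left ht (ray d j)) ?_ ?_
      (ray d (j + (1 : ℕ)))
    · exact (galeDet_ray_pos ht j (j := 1) le_rfl (by omega)).ne' hz
    · intro i hi
      simp only [mem_compl, mem_insert, mem_singleton, not_not] at hi
      rcases hi with rfl | rfl
      · have := galeDet_ray_pos ht k (j := 1) le_rfl (by omega)
        rw [Nat.cast_one, hjk] at this
        rw [galeDet_swap]
        linarith
      · rw [hjk, galeDet_self]
    · intro i hi
      obtain ⟨q, hq, rfl⟩ := mem_image.mp (hmem i hi)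
      have := mem_range.mp hq
      exact galeDet_ray_nonneg ht j (by omega)
  -- The last ray of the arc. Both `k` and `k + 1` lie within `d + 1` steps after it; the case `k +
  -- 1 = j` was handled with the first ray.
  · set r := j + ((d + 1 : ℕ) : ZMod (2 * d + 3)) with hr
    have hz := hT.dep_eq_zero ht hk hS (isMomentDep_galeDet_right ht (ray d r)) ?_ ?_ (ray d j)
    · exact (galeDet_ray_pos ht j (j := d + 1) (by omega) le_rfl).ne' hz
    · intro i hi
      simp only [mem_compl, mem_insert, mem_singleton, not_not] at hi
      have hk' : k = r + ((m - (d + 1) : ℕ) : ZMod (2 * d + 3)) := by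
        rw [hr, add_assoc, ← Nat.cast_add, Nat.add_sub_cancel' (by omega), hkm]
      have hk1' : k + 1 = r + ((m - (d + 1) + 1 : ℕ) : ZMod (2 * d + 3)) := by
        rw [hk']; push_cast; ring
      rcases hi with rfl | rfl
      · rw [galeDet_swap, hk', neg_nonpos]
        exact galeDet_ray_nonneg ht r (by omega)
      · rw [galeDet_swap, hk1', neg_nonpos]
        exact galeDet_ray_nonneg ht r (by omega)
    · intro i hi
      obtain ⟨q, hq, rfl⟩ := mem_image.mp (hmem i hi)
      have hq := mem_range.mp hq
      have := galeDet_ray_nonneg ht (j + q) (j := d + 1 - q) (by omega)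
      rwa [add_assoc, ← Nat.cast_add, Nat.add_sub_cancel' (by omega)] at this

/-- The internal `d`-simplices in their cyclic order. -/
noncomputable def internalEquiv (ht : StrictMono t) : ZMod (2 * d + 3) ≃ InternalSimplex d t :=
  Equiv.ofBijective (fun j => ⟨arcSimplex d j, isInternal_arcSimplex ht j⟩) <| by
    refine ⟨fun a b h => rayArc_injective (compl_injective (congrArg Subtype.val h)), ?_⟩
    rintro ⟨A, hA⟩
    obtain ⟨j, rfl⟩ := hA.exists_eq_arcSimplex ht
    exact ⟨j, rfl⟩

theorem mem_triangulationComplex_iff (ht : StrictMono t) (σ : Finset (InternalSimplex d t)) :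
    σ ∈ (triangulationComplex d t).faces ↔
      σ.Nonempty ∧ ∃ i, ∀ v ∈ σ, ∃ m : ℕ, m ≤ d ∧ v = internalEquiv ht (i + m) := by
  refine and_congr_right fun _ => ⟨?_, ?_⟩
  · rintro ⟨T, hT, hσ⟩
    obtain ⟨k, hk⟩ := hT.exists_chamber_mem ht
    refine ⟨k - d, fun v hv => ?_⟩
    obtain ⟨S, hS, hvS⟩ := hσ hv
    obtain ⟨j, rfl⟩ := (internalEquiv ht).surjective v
    have hle := hT.val_sub_le ht hk hS hvS
    refine ⟨d - (k - j).val, by omega, congrArg _ ?_⟩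
    rw [Nat.cast_sub hle]
    simp
  · rintro ⟨i, hi⟩
    refine ⟨_, isTriangulation_chamberTriangulation ht (i + d), fun v hv => ?_⟩
    obtain ⟨m, hm, rfl⟩ := hi v hv
    -- One simplex suffices: the one omitting the rays `i + d` and `i + d + 1`, which lie on every
    -- arc that starts at `i + m` with `m ≤ d`.
    refine ⟨_, ⟨i + d, 0, 0, by omega, by simp, rfl⟩, ?_⟩
    change (rayArc d (i + m))ᶜ ⊆ _
    refine compl_subset_compl.mpr fun z hz => ?_
    rcases mem_insert.mp hz with rfl | hz
    · have := ray_add_mem_rayArc (j := i + (m : ZMod (2 * d + 3))) (m := d - m) (by omega)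
      rwa [add_assoc, ← Nat.cast_add, Nat.add_sub_cancel' hm] at this
    · rw [mem_singleton.mp hz]
      have := ray_add_mem_rayArc (j := i + (m : ZMod (2 * d + 3))) (m := d - m + 1) (by omega)
      rw [add_assoc, ← Nat.cast_add, show m + (d - m + 1) = d + (0 + 0 + 1) by omega] at this
      rwa [add_assoc, ← Nat.cast_add]

end Triangulations
end CyclicPolytope

namespace PreAbstractSimplicialComplex

open Finset

/-! ### Facets and non-shellability of the arc complex. -/

section ArcComplex

variable {V : Type*} {n : ℕ}

/-- The arc `c i, c (i + 1), …, c (i + d)`. -/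
def arc (c : ZMod n ≃ V) (d : ℕ) (i : ZMod n) : Finset V :=
  ((range (d + 1)).image fun m : ℕ => i + (m : ZMod n)).map c.toEmbedding

/-- The faces of `K` are the nonempty subsets of the arcs `c i, c (i + 1), …, c (i + d)`. -/
def IsArcComplex (K : PreAbstractSimplicialComplex V) (c : ZMod n ≃ V) (d : ℕ) : Prop :=
  ∀ σ, σ ∈ K.faces ↔ σ.Nonempty ∧ ∃ i, σ ⊆ arc c d i

variable {K : PreAbstractSimplicialComplex V} {c : ZMod n ≃ V} {d : ℕ}

theorem mem_arc {i : ZMod n} {v : V} : v ∈ arc c d i ↔ ∃ m : ℕ, m ≤ d ∧ v = c (i + m) := by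
  simp only [arc, mem_map_equiv, mem_image, mem_range, Nat.lt_succ_iff, Equiv.eq_symm_apply,
    eq_comm]

theorem isArcComplex_cycle (c : ZMod n ≃ V) : (cycle c).IsArcComplex c 1 := by
  refine fun σ => and_congr_right fun _ => exists_congr fun i => forall₂_congr fun v _ => ?_
  rw [mem_arc]
  constructor
  · rintro (h | h)
    · exact ⟨0, zero_le_one, by simpa using h⟩
    · exact ⟨1, le_rfl, by simpa using h⟩
  · rintro ⟨m, hm, h⟩
    rcases Nat.le_one_iff_eq_zero_or_eq_one.mp hm with rfl | rfl
    · exact Or.inl (by simpa using h)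
    · exact Or.inr (by simpa using h)

theorem card_arc (hn : d < n) (i : ZMod n) : (arc c d i).card = d + 1 := by
  rw [arc, card_map, card_image_of_injOn, card_range]
  intro a ha b hb hab
  have ha := mem_range.mp ha
  have hb := mem_range.mp hb
  have := congrArg (fun v => (v - i).val) hab
  simpa only [CyclicPolytope.add_natCast_sub_val i (show a < n by omega),
    CyclicPolytope.add_natCast_sub_val i (show b < n by omega)] using this

theorem IsArcComplex.arc_mem (hK : K.IsArcComplex c d) (i : ZMod n) : arc c d i ∈ K.faces :=
  (hK _).mpr ⟨⟨c i, mem_arc.mpr ⟨0, Nat.zero_le _, by simp⟩⟩, i, Subset.rfl⟩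

theorem IsArcComplex.cycle_le (hK : K.IsArcComplex c d) (hd : 1 ≤ d) : cycle c ≤ K := by
  intro σ hσ
  obtain ⟨hne, i, hi⟩ := (isArcComplex_cycle c σ).mp hσ
  refine (hK σ).mpr ⟨hne, i, fun v hv => ?_⟩
  obtain ⟨m, hm, h⟩ := mem_arc.mp (hi hv)
  exact mem_arc.mpr ⟨m, hm.trans hd, h⟩

variable [NeZero n]

theorem apply_mem_arc_iff {i k : ZMod n} (hn : d < n) : c k ∈ arc c d i ↔ (k - i).val ≤ d := by
  rw [mem_arc]
  constructor
  · rintro ⟨m, hm, h⟩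
    rw [c.injective h, CyclicPolytope.add_natCast_sub_val _ (by omega)]
    exact hm
  · exact fun h => ⟨_, h, by simp⟩

theorem apply_add_mem_arc_iff {i : ZMod n} {m : ℕ} (hn : d < n) (hm : m < n) :
    c (i + m) ∈ arc c d i ↔ m ≤ d := by
  rw [apply_mem_arc_iff hn, CyclicPolytope.add_natCast_sub_val _ hm]

/-- For distinct starting points each arc would contain the start of the other, at offsets at most
`d` that add up to `n > 2d`. -/
theorem eq_of_arc_subset_arc (hn : 2 * d < n) {i j : ZMod n} (h : arc c d i ⊆ arc c d j) :
    i = j := by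
  have heq : arc c d i = arc c d j := eq_of_subset_of_card_le h (by
    rw [card_arc (by omega), card_arc (by omega)])
  by_contra hne
  have h1 : (i - j).val ≤ d := by
    rw [← apply_mem_arc_iff (c := c) (by omega), ← heq, apply_mem_arc_iff (by omega)]; simp
  have h2 : (j - i).val ≤ d := by
    rw [← apply_mem_arc_iff (c := c) (by omega), heq, apply_mem_arc_iff (by omega)]; simp
  have h3 : (j - i).val = n - (i - j).val := by
    have : NeZero (i - j) := ⟨sub_ne_zero.mpr hne⟩
    rw [← neg_sub, ZMod.val_neg_of_ne_zero]
  omega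

theorem IsArcComplex.isFacet_iff (hK : K.IsArcComplex c d) (hn : 2 * d < n) {F : Finset V} :
    K.IsFacet F ↔ ∃ i, arc c d i = F := by
  constructor
  · intro h
    obtain ⟨-, i, hi⟩ := (hK F).mp h.prop
    exact ⟨i, (h.eq_of_le (hK.arc_mem i) hi).symm⟩
  · rintro ⟨i, rfl⟩
    refine ⟨hK.arc_mem i, fun G hG hle => ?_⟩
    obtain ⟨-, j, hj⟩ := (hK G).mp hG
    rw [eq_of_arc_subset_arc hn (hle.trans hj)]
    exact hj

theorem IsArcComplex.isPureOfDim (hK : K.IsArcComplex c d) (hn : 2 * d < n) :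
    K.IsPureOfDim d := by
  intro F hF
  obtain ⟨i, rfl⟩ := (hK.isFacet_iff hn).mp hF
  exact card_arc (by omega) i

theorem add_natCast_eq_add_add {n : ℕ} (i : ZMod n) {m e q : ℕ} (h : m + n = e + q) :
    i + (m : ZMod n) = i + e + q := by
  have := congrArg (Nat.cast : ℕ → ZMod n) h
  rw [Nat.cast_add, Nat.cast_add, ZMod.natCast_self, add_zero] at this
  rw [this, add_assoc]

/-- Two arcs which share `d` elements are neighbours. -/
theorem eq_add_one_or_eq_sub_one (hd : 2 ≤ d) (hn : n = 2 * d + 3) {i j : ZMod n} (hij : i ≠ j)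
    {H : Finset V} (hi : H ⊆ arc c d i) (hj : H ⊆ arc c d j) (hcard : H.card = d) :
    j = i + 1 ∨ j = i - 1 := by
  classical
  obtain ⟨e, he, rfl⟩ := CyclicPolytope.exists_eq_add_natCast i j
  have he0 : e ≠ 0 := by rintro rfl; simp at hij
  by_cases he1 : e = 1
  · left; rw [he1, Nat.cast_one]
  by_cases he2 : e = n - 1
  · right; rw [he2, Nat.cast_sub (by omega), ZMod.natCast_self]; ring
  exfalso
  -- Two elements of the first arc missing from the second leave at most `d - 1` common ones. They
  -- are found at the start of the first arc if `e ≤ d + 2`, and at its end otherwise.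
  have key : ∀ x y : ℕ, x ≤ d → y ≤ d → x ≠ y → c (i + x) ∉ arc c d (i + e) →
      c (i + y) ∉ arc c d (i + e) → False := by
    intro x y hx hy hxy h1 h2
    have hsub : H ⊆ ((arc c d i).erase (c (i + x))).erase (c (i + y)) := fun v hv =>
      mem_erase.mpr ⟨fun h => h2 (h ▸ hj hv), mem_erase.mpr ⟨fun h => h1 (h ▸ hj hv), hi hv⟩⟩
    have hne : c (i + y) ≠ c (i + x) := fun h => hxy (by
      have := congrArg (fun v => (v - i).val) (c.injective h)
      simp only [CyclicPolytope.add_natCast_sub_val i (show x < n by omega),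
        CyclicPolytope.add_natCast_sub_val i (show y < n by omega)] at this
      exact this.symm)
    have := card_le_card hsub
    rw [card_erase_of_mem (mem_erase.mpr ⟨hne, mem_arc.mpr ⟨y, hy, rfl⟩⟩),
      card_erase_of_mem (mem_arc.mpr ⟨x, hx, rfl⟩), card_arc (by omega), hcard] at this
    omega
  have hout : ∀ x : ℕ, ∀ q : ℕ, (x + n = e + q ∨ x = e + q) → d < q → q < n →
      c (i + x) ∉ arc c d (i + e) := by
    intro x q hx hq hqn
    have : i + (x : ZMod n) = i + e + q := by
      rcases hx with hx | hx
      · exact add_natCast_eq_add_add i hx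
      · rw [hx, Nat.cast_add, add_assoc]
    rw [this, apply_add_mem_arc_iff (by omega) hqn]
    omega
  by_cases hed : e ≤ d + 2
  · exact key 0 1 (by omega) (by omega) (by omega) (hout 0 (n - e) (by omega) (by omega) (by omega))
      (hout 1 (n + 1 - e) (by omega) (by omega) (by omega))
  · exact key d (d - 1) (by omega) (by omega) (by omega)
      (hout d (n + d - e) (by omega) (by omega) (by omega))
      (hout (d - 1) (n + d - 1 - e) (by omega) (by omega) (by omega))

/-- Consider the last two facets of a shelling. If they are neighbours, the last but one has an end
vertex that occurs earlier, but not in its only earlier neighbour. If they are not, they cut the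
cycle into two nonempty parts, while each earlier facet is linked to the first one through earlier
neighbours. -/
theorem IsArcComplex.not_isShellable (hK : K.IsArcComplex c d) (hd : 2 ≤ d)
    (hn : n = 2 * d + 3) : ¬ K.IsShellable := by
  rintro ⟨p, F, hinj, hrange, hshell⟩
  have hF : ∀ a, ∃ i, arc c d i = F a := fun a => by
    rw [← hK.isFacet_iff (by omega)]
    exact hrange.subset ⟨a, rfl⟩
  choose φ hφ using hF
  have hφbij : Function.Bijective φ := by
    refine ⟨fun a b h => hinj (by rw [← hφ a, ← hφ b, h]), fun i => ?_⟩
    obtain ⟨a, ha⟩ := hrange.superset ((hK.isFacet_iff (by omega)).mpr ⟨i, rfl⟩)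
    exact ⟨a, eq_of_arc_subset_arc (c := c) (d := d) (by omega) (by rw [hφ a, ha])⟩
  obtain rfl : p = n := by
    have := Fintype.card_of_bijective hφbij
    rwa [Fintype.card_fin, ZMod.card] at this
  -- What the shelling condition yields: a later facet has an earlier neighbour, and each of its
  -- vertices already used lies in such a neighbour.
  have hnb : ∀ b : Fin p, 0 < (b : ℕ) → (∃ b' < b, φ b' = φ b + 1 ∨ φ b' = φ b - 1) ∧
      ∀ v ∈ arc c d (φ b), (∃ j < b, v ∈ arc c d (φ j)) →
        ∃ b' < b, (φ b' = φ b + 1 ∨ φ b' = φ b - 1) ∧ v ∈ arc c d (φ b') := by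
    intro b hb
    obtain ⟨ℋ, ⟨H₀, hH₀⟩, hsub, heq⟩ := hshell b hb
    have hcore : ∀ H ∈ ℋ, ∃ b' < b, (φ b' = φ b + 1 ∨ φ b' = φ b - 1) ∧ H ⊆ arc c d (φ b') := by
      intro H hH
      obtain ⟨hHb, hHc⟩ := hsub H hH
      have hHc' : H.card = d := by
        rw [← hφ b, card_arc (by omega)] at hHc; omega
      have hmem : H ∈ {G : Finset V | G.Nonempty ∧ ∃ H ∈ ℋ, G ⊆ H} :=
        ⟨card_pos.mp (by omega), H, hH, Subset.rfl⟩
      rw [← heq] at hmem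
      obtain ⟨-, -, j, hjb, hHj⟩ := hmem
      refine ⟨j, hjb, eq_add_one_or_eq_sub_one (c := c) hd hn ?_ (by rwa [hφ b])
        (by rwa [hφ j]) hHc', by rwa [hφ j]⟩
      exact fun h => hjb.ne' (hφbij.1 h)
    refine ⟨?_, fun v hv hvj => ?_⟩
    · obtain ⟨b', hb', h, -⟩ := hcore H₀ hH₀
      exact ⟨b', hb', h⟩
    · obtain ⟨j, hjb, hvj⟩ := hvj
      have hmem : {v} ∈ {G : Finset V | G.Nonempty ∧ G ⊆ F b ∧ ∃ j < b, G ⊆ F j} :=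
        ⟨singleton_nonempty v, by rw [← hφ b]; simpa using hv, j, hjb, by
          rw [← hφ j]; simpa using hvj⟩
      rw [heq] at hmem
      obtain ⟨-, H, hH, hvH⟩ := hmem
      obtain ⟨b', hb', h, hHb'⟩ := hcore H hH
      exact ⟨b', hb', h, hHb' (hvH (mem_singleton_self v))⟩
  let a : Fin p := ⟨p - 2, by omega⟩
  let z : Fin p := ⟨p - 1, by omega⟩
  have hlast : ∀ b : Fin p, b ≠ a → b ≠ z → b < a := by
    intro b h1 h2
    have h1' : (b : ℕ) ≠ p - 2 := fun h => h1 (Fin.ext h)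
    have h2' : (b : ℕ) ≠ p - 1 := fun h => h2 (Fin.ext h)
    have := b.2
    rw [Fin.lt_def]
    change (b : ℕ) < p - 2
    omega
  have haz : a < z := by rw [Fin.lt_def]; change p - 2 < p - 1; omega
  have ha0 : 0 < (a : ℕ) := by change 0 < p - 2; omega
  obtain ⟨e, he, hze⟩ := CyclicPolytope.exists_eq_add_natCast (φ a) (φ z)
  have he0 : e ≠ 0 := by
    rintro rfl
    rw [Nat.cast_zero, add_zero] at hze
    exact haz.ne' (hφbij.1 hze)
  -- an index different from the last two occurs before them
  have hbefore : ∀ m : ℕ, m < p → m ≠ 0 → m ≠ e → ∃ b < a, φ b = φ a + m := by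
    intro m hm hm0 hme
    obtain ⟨b, hb⟩ := hφbij.2 (φ a + m)
    refine ⟨b, hlast b ?_ ?_, hb⟩
    · rintro rfl
      have := congrArg (fun v => (v - φ a).val) hb
      simp only [CyclicPolytope.add_natCast_sub_val _ hm, sub_self, ZMod.val_zero] at this
      exact hm0 this.symm
    · rintro rfl
      rw [hze] at hb
      have := congrArg (fun v => (v - φ a).val) hb
      simp only [CyclicPolytope.add_natCast_sub_val _ hm,
        CyclicPolytope.add_natCast_sub_val _ he] at this
      exact hme this.symm
  have hsub1 : φ a - 1 = φ a + ((p - 1 : ℕ) : ZMod p) := by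
    rw [Nat.cast_sub (by omega), ZMod.natCast_self]; ring
  -- The end vertex `φ a + d` lies in the arc from `φ a + 2` because `d ≥ 2`, but not in the arc
  -- from `φ a - 1`.
  by_cases he1 : e = 1
  · obtain ⟨b, hb, hb2⟩ := hbefore 2 (by omega) (by omega) (by omega)
    have hv : c (φ a + d) ∈ arc c d (φ a) := mem_arc.mpr ⟨d, le_rfl, rfl⟩
    obtain ⟨b', hb', h | h, hmem⟩ := (hnb a ha0).2 _ hv ⟨b, hb, by
      rw [hb2, show φ a + (d : ZMod p) = φ a + (2 : ℕ) + (d - 2 : ℕ) by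
        rw [add_assoc, ← Nat.cast_add, Nat.add_sub_cancel' hd],
        apply_add_mem_arc_iff (by omega) (by omega)]
      omega⟩
    · rw [he1, Nat.cast_one, ← h] at hze
      exact (hb'.trans haz).ne' (hφbij.1 hze)
    · rw [h, show φ a + (d : ZMod p) = φ a - 1 + (d + 1 : ℕ) by push_cast; ring,
        apply_add_mem_arc_iff (by omega) (by omega)] at hmem
      omega
  by_cases he2 : e = p - 1
  · obtain ⟨b, hb, hb2⟩ := hbefore (p - 2) (by omega) (by omega) (by omega)
    have hv : c (φ a) ∈ arc c d (φ a) := mem_arc.mpr ⟨0, Nat.zero_le _, by simp⟩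
    obtain ⟨b', hb', h | h, hmem⟩ := (hnb a ha0).2 _ hv ⟨b, hb, by
      rw [CyclicPolytope.add_natCast_eq_of_add_eq hb2 (show p - 2 + 2 = p by omega),
        apply_add_mem_arc_iff (by omega) (by omega)]
      exact hd⟩
    · rw [CyclicPolytope.add_natCast_eq_of_add_eq (j := φ a) (x := φ b') (m := 1) (by rw [h, Nat.cast_one])
        (show 1 + (p - 1) = p by omega), apply_add_mem_arc_iff (by omega) (by omega)] at hmem
      omega
    · rw [he2, ← hsub1, ← h] at hze
      exact (hb'.trans haz).ne' (hφbij.1 hze)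
  -- the two sides of the complement of the last two indices are never joined
  have hadj : ∀ b b' : Fin p, b < a → b' < a → φ b' = φ b + 1 →
      ((φ b - φ a).val < e ↔ (φ b' - φ a).val < e) := by
    intro b b' hb hb' h
    obtain ⟨m, hm, hbm⟩ := CyclicPolytope.exists_eq_add_natCast (φ a) (φ b)
    have hm0 : m ≠ 0 := by
      rintro rfl
      rw [Nat.cast_zero, add_zero] at hbm
      exact hb.ne (hφbij.1 hbm)
    have hme : m ≠ e := by
      rintro rfl
      exact (hb.trans haz).ne (hφbij.1 (hbm.trans hze.symm))
    have hb'm : φ b' = φ a + (m + 1 : ℕ) := by rw [h, hbm]; push_cast; ring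
    have hm1 : m + 1 ≠ p := by
      intro hmp
      rw [hmp, ZMod.natCast_self, add_zero] at hb'm
      exact hb'.ne (hφbij.1 hb'm)
    have hme1 : m + 1 ≠ e := by
      rintro rfl
      exact (hb'.trans haz).ne (hφbij.1 (hb'm.trans hze.symm))
    rw [hbm, hb'm, CyclicPolytope.add_natCast_sub_val _ hm,
      CyclicPolytope.add_natCast_sub_val _ (by omega)]
    omega
  have hside : ∀ k : ℕ, ∀ hk : k < p, (⟨k, hk⟩ : Fin p) < a →
      ((φ ⟨k, hk⟩ - φ a).val < e ↔ (φ ⟨0, by omega⟩ - φ a).val < e) := by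
    intro k
    induction k using Nat.strong_induction_on with
    | _ k ih =>
      intro hk hka
      rcases Nat.eq_zero_or_pos k with rfl | hk0
      · rfl
      obtain ⟨b', hb', h⟩ := (hnb ⟨k, hk⟩ hk0).1
      rw [← ih b' hb' b'.2 (hb'.trans hka)]
      rcases h with h | h
      · exact hadj _ _ hka (hb'.trans hka) h
      · exact (hadj _ _ (hb'.trans hka) hka (by rw [h]; ring)).symm
  obtain ⟨b₁, hb₁, h₁⟩ := hbefore 1 (by omega) (by omega) (by omega)
  obtain ⟨b₂, hb₂, h₂⟩ := hbefore (p - 1) (by omega) (by omega) (by omega)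
  have s₁ := hside b₁ b₁.2 hb₁
  have s₂ := hside b₂ b₂.2 hb₂
  rw [Fin.eta, h₁, CyclicPolytope.add_natCast_sub_val _ (by omega)] at s₁
  rw [Fin.eta, h₂, CyclicPolytope.add_natCast_sub_val _ (by omega)] at s₂
  have : p - 1 < e := s₂.mpr (s₁.mp (by omega))
  omega

end ArcComplex
end PreAbstractSimplicialComplex

namespace PreAbstractSimplicialComplex

open Finset

/-! ### Retraction of the realization onto the polygon. -/

section ArcRealization

variable {V : Type*} {n : ℕ} {K : PreAbstractSimplicialComplex V} {c : ZMod n ≃ V} {d : ℕ}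

theorem addCircle_coe_eq_coe {n : ℕ} {a b : ℝ} (m : ℤ) (h : a = b + m * n) :
    (a : AddCircle (n : ℝ)) = b := by
  rw [h, AddCircle.coe_add, add_eq_left, AddCircle.coe_eq_zero_iff]
  exact ⟨m, by simp⟩

theorem one_le_norm_coe {x : ℝ} (h1 : x ≤ -1) (h2 : 1 - n ≤ x) :
    1 ≤ ‖(x : AddCircle (n : ℝ))‖ := by
  rw [AddCircle.norm_eq]
  set z := round ((n : ℝ)⁻¹ * x)
  have hn0 : (0 : ℝ) ≤ n := Nat.cast_nonneg _
  rcases le_or_gt 0 z with hz | hz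
  · have : (0 : ℝ) ≤ z := by exact_mod_cast hz
    rw [le_abs']
    left
    nlinarith
  · have : (z : ℝ) ≤ -1 := by exact_mod_cast Int.le_sub_one_of_lt hz
    rw [le_abs']
    right
    nlinarith

/-- The point of the polygon `c 0, c 1, …` at parameter `s`. -/
noncomputable def polygonPoint (c : ZMod n ≃ V) (s : AddCircle (n : ℝ)) (v : V) : ℝ :=
  max 0 (1 - ‖s - (((c.symm v).val : ℝ) : AddCircle (n : ℝ))‖)

theorem continuous_polygonPoint (c : ZMod n ≃ V) : Continuous (polygonPoint c) := by
  unfold polygonPoint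
  fun_prop

variable [NeZero n]

theorem exists_val_eq {n : ℕ} [NeZero n] (i k : ZMod n) :
    ∃ m : ℤ, (k.val : ℤ) = i.val + (k - i).val + m * n := by
  have : ((k.val - i.val - (k - i).val : ℤ) : ZMod n) = 0 := by
    push_cast
    simp
  obtain ⟨m, hm⟩ := (ZMod.intCast_zmod_eq_zero_iff_dvd _ n).mp this
  exact ⟨m, by linarith⟩

theorem polygonPoint_apply (c : ZMod n ≃ V) (hn : 2 < n) (k v : ZMod n) {τ : ℝ} (h0 : 0 ≤ τ)
    (h1 : τ ≤ 1) : polygonPoint c ((k.val + τ : ℝ) : AddCircle (n : ℝ)) (c v) =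
      (if v = k then 1 - τ else 0) + if v = k + 1 then τ else 0 := by
  obtain ⟨m, hm⟩ := exists_val_eq k v
  have hn' : (2 : ℝ) < n := by exact_mod_cast hn
  have hcoe : ((k.val + τ : ℝ) : AddCircle (n : ℝ)) - ((v.val : ℝ) : AddCircle (n : ℝ)) =
      ((τ - (v - k).val : ℝ) : AddCircle (n : ℝ)) := by
    rw [← AddCircle.coe_sub]
    refine addCircle_coe_eq_coe (-m) ?_
    have : (v.val : ℝ) = k.val + (v - k).val + m * n := by exact_mod_cast hm
    rw [this]; push_cast; ring
  rw [polygonPoint, Equiv.symm_apply_apply, hcoe]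
  have hsmall : ∀ y : ℝ, |y| ≤ 1 → ‖(y : AddCircle (n : ℝ))‖ = |y| := fun y hy => by
    rw [AddCircle.norm_coe_eq_abs_iff _ (by positivity), Nat.abs_cast]
    linarith
  obtain ⟨q, hq, rfl⟩ := CyclicPolytope.exists_eq_add_natCast k v
  rw [CyclicPolytope.add_natCast_sub_val _ hq]
  have hfact : Fact (1 < n) := ⟨by omega⟩
  rcases Nat.lt_or_ge q 2 with hq2 | hq2
  · interval_cases q
    · rw [Nat.cast_zero, Nat.cast_zero, sub_zero, add_zero, hsmall τ (abs_le.mpr ⟨by linarith, h1⟩),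
        abs_of_nonneg h0, max_eq_right (by linarith), if_pos rfl, if_neg (by simp),
        add_zero]
    · have habs : |τ - 1| = 1 - τ := by rw [abs_sub_comm, abs_of_nonneg (by linarith)]
      rw [Nat.cast_one, Nat.cast_one, hsmall (τ - 1) (by rw [habs]; linarith), habs,
        if_neg (by simp), if_pos rfl, zero_add, sub_sub_cancel, max_eq_right h0]
  · have hq2' : (2 : ℝ) ≤ q := by exact_mod_cast hq2
    have hqn : (q : ℝ) + 1 ≤ n := by exact_mod_cast hq
    have hle := one_le_norm_coe (n := n) (x := τ - q) (by linarith) (by linarith)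
    have hval : ∀ w : ℕ, w < 2 → k + (q : ZMod n) ≠ k + (w : ZMod n) := fun w hw h => by
      have := congrArg (fun v => (v - k).val) h
      simp only [CyclicPolytope.add_natCast_sub_val k hq,
        CyclicPolytope.add_natCast_sub_val k (show w < n by omega)] at this
      omega
    rw [max_eq_left (by linarith), if_neg (by simpa using hval 0 (by omega)),
      if_neg (by simpa using hval 1 (by omega)), add_zero]

theorem sum_polygonPoint_mul (c : ZMod n ≃ V) (hn : 2 < n) (k : ZMod n) {τ : ℝ} (h0 : 0 ≤ τ)
    (h1 : τ ≤ 1) (w : ZMod n → ℝ) :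
    ∑ v, polygonPoint c ((k.val + τ : ℝ) : AddCircle (n : ℝ)) (c v) * w v =
      (1 - τ) * w k + τ * w (k + 1) := by
  simp_rw [polygonPoint_apply c hn k _ h0 h1, add_mul, ite_mul, zero_mul, sum_add_distrib,
    sum_ite_eq', mem_univ, if_true]

theorem exists_eq_val_add (s : AddCircle (n : ℝ)) :
    ∃ (k : ZMod n) (τ : ℝ), 0 ≤ τ ∧ τ ≤ 1 ∧ s = ((k.val + τ : ℝ) : AddCircle (n : ℝ)) := by
  obtain ⟨y, rfl⟩ := QuotientAddGroup.mk_surjective s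
  refine ⟨(⌊y⌋ : ZMod n), Int.fract y, Int.fract_nonneg y, (Int.fract_lt_one y).le, ?_⟩
  have : ((⌊y⌋ - ((⌊y⌋ : ZMod n).val : ℤ) : ℤ) : ZMod n) = 0 := by
    push_cast; simp
  obtain ⟨m, hm⟩ := (ZMod.intCast_zmod_eq_zero_iff_dvd _ n).mp this
  refine addCircle_coe_eq_coe m ?_
  have hm' : (⌊y⌋ : ℝ) - ((⌊y⌋ : ZMod n).val : ℝ) = n * m := by exact_mod_cast hm
  linarith [Int.floor_add_fract y]

/-- The mean position of the mass `x`, lifted to the window of length `n` starting at `i`. -/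
noncomputable def meanLift (c : ZMod n ≃ V) (i : ZMod n) (x : V → ℝ) : ℝ :=
  i.val + ∑ k, x (c k) * ((k - i).val : ℝ)

theorem continuous_meanLift (c : ZMod n ≃ V) (i : ZMod n) : Continuous (meanLift c i) := by
  unfold meanLift
  fun_prop

/-- The two lifts of a vertex differ by a multiple of `n`. On the support this multiple is constant,
as it varies by at most `2d < n`, so the means differ by it too. -/
theorem meanLift_coe_eq (hdn : 2 * d < n) {x : V → ℝ} (h1 : ∑ k, x (c k) = 1) {i j : ZMod n}
    (hi : ∀ k, d < (k - i).val → x (c k) = 0) (hj : ∀ k, d < (k - j).val → x (c k) = 0) :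
    (meanLift c i x : AddCircle (n : ℝ)) = meanLift c j x := by
  let L : ZMod n → ℤ := fun k => i.val + (k - i).val - (j.val + (k - j).val)
  have hdvd : ∀ k, (n : ℤ) ∣ L k := fun k => by
    obtain ⟨a, ha⟩ := exists_val_eq i k
    obtain ⟨b, hb⟩ := exists_val_eq j k
    exact ⟨b - a, by simp only [L]; linarith⟩
  obtain ⟨k₀, hk₀⟩ : ∃ k, x (c k) ≠ 0 := by
    by_contra! h
    simp [h] at h1
  have hbd : ∀ k, x (c k) ≠ 0 → (k - i).val ≤ d ∧ (k - j).val ≤ d := fun k hk =>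
    ⟨not_lt.mp fun h => hk (hi k h), not_lt.mp fun h => hk (hj k h)⟩
  have hconst : ∀ k, x (c k) ≠ 0 → L k = L k₀ := fun k hk => by
    obtain ⟨a1, a2⟩ := hbd k hk
    obtain ⟨b1, b2⟩ := hbd k₀ hk₀
    refine sub_eq_zero.mp (Int.eq_zero_of_abs_lt_dvd ((hdvd k).sub (hdvd k₀)) ?_)
    rw [abs_lt]
    simp only [L]
    constructor <;> omega
  obtain ⟨m, hm⟩ := hdvd k₀
  refine addCircle_coe_eq_coe m ?_
  have hsum : ∀ i : ZMod n, meanLift c i x = ∑ k, x (c k) * ((i.val : ℝ) + (k - i).val) := fun i => by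
    simp_rw [meanLift, mul_add, sum_add_distrib, ← sum_mul, h1, one_mul]
  have hdiff : meanLift c i x - meanLift c j x = ∑ k, x (c k) * (L k₀ : ℝ) := by
    rw [hsum, hsum, ← sum_sub_distrib]
    refine sum_congr rfl fun k _ => ?_
    by_cases hk : x (c k) = 0
    · simp [hk]
    · rw [← hconst k hk, ← mul_sub]
      simp only [L]
      push_cast
      ring
  rw [← sum_mul, h1, one_mul, hm] at hdiff
  push_cast at hdiff
  linarith

open Classical in
/-- The mean position on the circle of the mass `x`. -/
noncomputable def meanPosition (c : ZMod n ≃ V) (d : ℕ) (x : V → ℝ) : AddCircle (n : ℝ) :=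
  -- The chosen window is immaterial by `meanLift_coe_eq`; the value `0` never matters on the
  -- realization.
  if h : ∃ i, ∀ k, d < (k - i).val → x (c k) = 0 then (meanLift c h.choose x : AddCircle (n : ℝ))
  else 0

theorem meanPosition_eq (hdn : 2 * d < n) {x : V → ℝ} (h1 : ∑ k, x (c k) = 1) {i : ZMod n}
    (hi : ∀ k, d < (k - i).val → x (c k) = 0) :
    meanPosition c d x = (meanLift c i x : AddCircle (n : ℝ)) := by
  have h : ∃ i, ∀ k, d < (k - i).val → x (c k) = 0 := ⟨i, hi⟩
  rw [meanPosition, dif_pos h]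
  exact meanLift_coe_eq hdn h1 h.choose_spec hi

theorem meanPosition_polygonPoint (hd : 1 ≤ d) (hdn : 2 * d < n) (s : AddCircle (n : ℝ)) :
    meanPosition c d (polygonPoint c s) = s := by
  obtain ⟨k, τ, h0, h1, rfl⟩ := exists_eq_val_add s
  have hsum : ∑ v, polygonPoint c ((k.val + τ : ℝ) : AddCircle (n : ℝ)) (c v) = 1 := by
    simpa using sum_polygonPoint_mul c (by omega) k h0 h1 fun _ => 1
  have hfact : Fact (1 < n) := ⟨by omega⟩
  rw [meanPosition_eq hdn hsum (i := k), meanLift, sum_polygonPoint_mul c (by omega) k h0 h1]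
  · simp [ZMod.val_one]
  · intro v hv
    rw [polygonPoint_apply c (by omega) k v h0 h1, if_neg, if_neg, add_zero]
    · rintro rfl
      rw [add_sub_cancel_left, ZMod.val_one] at hv
      omega
    · rintro rfl
      simp at hv

/-- The mean of a mass on an arc lies between the ends of the arc, so its polygon point is supported
on the same arc. This keeps the straight-line homotopy inside a face. -/
theorem polygonPoint_meanPosition_apply (hd : 1 ≤ d) (hdn : 2 * d < n) {x : V → ℝ}
    (h0 : ∀ v, 0 ≤ x v) (h1 : ∑ k, x (c k) = 1) {i : ZMod n}
    (hi : ∀ k, d < (k - i).val → x (c k) = 0) (v : ZMod n) (hv : d < (v - i).val) :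
    polygonPoint c (meanPosition c d x) (c v) = 0 := by
  set m := ∑ k, x (c k) * ((k - i).val : ℝ) with hm
  have hm0 : 0 ≤ m := sum_nonneg fun k _ => mul_nonneg (h0 _) (Nat.cast_nonneg _)
  have hmd : m ≤ d := by
    calc m ≤ ∑ k, x (c k) * (d : ℝ) := sum_le_sum fun k _ => by
          by_cases hk : d < (k - i).val
          · simp [hi k hk]
          · exact mul_le_mul_of_nonneg_left (by exact_mod_cast not_lt.mp hk) (h0 _)
      _ = d := by rw [← sum_mul, h1, one_mul]
  have hfl := Nat.floor_le hm0
  have hfl' := Nat.lt_floor_add_one m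
  have hfd : ⌊m⌋₊ ≤ d := Nat.floor_le_of_le hmd
  set τ := m - ⌊m⌋₊ with hτ
  have hcoe : meanPosition c d x =
      (((i + (⌊m⌋₊ : ZMod n)).val + τ : ℝ) : AddCircle (n : ℝ)) := by
    rw [meanPosition_eq hdn h1 hi, meanLift, ← hm]
    obtain ⟨z, hz⟩ := exists_val_eq i (i + (⌊m⌋₊ : ZMod n))
    rw [CyclicPolytope.add_natCast_sub_val _ (by omega)] at hz
    have hz' : ((i + (⌊m⌋₊ : ZMod n)).val : ℝ) = i.val + ⌊m⌋₊ + z * n := by exact_mod_cast hz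
    refine addCircle_coe_eq_coe (-z) ?_
    rw [hz', hτ]; push_cast; ring
  rw [hcoe, polygonPoint_apply c (by omega) _ _ (by linarith) (by linarith), if_neg, zero_add]
  · split_ifs with h
    · rw [h, add_assoc, ← Nat.cast_add_one, CyclicPolytope.add_natCast_sub_val _ (by omega)] at hv
      -- The only way to leave the arc is to start an edge at its last vertex, and then `m ≤ d`
      -- forces `τ = 0`.
      have hd' : ⌊m⌋₊ = d := by omega
      have : (⌊m⌋₊ : ℝ) = d := by exact_mod_cast hd'
      linarith
    · rfl
  · rintro rfl
    rw [CyclicPolytope.add_natCast_sub_val _ (by omega)] at hv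
    omega

variable [Finite V]

theorem sum_apply_eq_sum {σ : Finset V} {x : V → ℝ} (h : ∀ v, v ∉ σ → x v = 0) (c : ZMod n ≃ V) :
    ∑ k, x (c k) = ∑ v ∈ σ, x v := by
  have := Fintype.ofFinite V
  rw [c.sum_comp x]
  exact (sum_subset (subset_univ σ) fun v _ hv => h v hv).symm

theorem IsArcComplex.mem_realization_iff (hK : K.IsArcComplex c d) (hn : d < n) {x : V → ℝ} :
    x ∈ K.realization ↔ (∀ v, 0 ≤ x v) ∧ ∑ k, x (c k) = 1 ∧
      ∃ i, ∀ k, d < (k - i).val → x (c k) = 0 := by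
  refine and_congr_right fun _ => ⟨?_, ?_⟩
  · rintro ⟨σ, hσ, h0, h1⟩
    obtain ⟨-, i, hi⟩ := (hK σ).mp hσ
    refine ⟨by rw [sum_apply_eq_sum h0 c, h1], i, fun k hk => h0 _ fun hkσ => ?_⟩
    have := (apply_mem_arc_iff hn).mp (hi hkσ)
    omega
  · rintro ⟨h1, i, hi⟩
    have h0 : ∀ v, v ∉ arc c d i → x v = 0 := fun v hv => by
      obtain ⟨k, rfl⟩ := c.surjective v
      rw [apply_mem_arc_iff hn, not_le] at hv
      exact hi k hv
    exact ⟨_, hK.arc_mem i, h0, by rw [← sum_apply_eq_sum h0 c, h1]⟩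

theorem IsArcComplex.polygonPoint_mem (hK : K.IsArcComplex c d) (hd : 1 ≤ d) (hdn : 2 * d < n)
    (s : AddCircle (n : ℝ)) : polygonPoint c s ∈ K.realization := by
  obtain ⟨k, τ, h0, h1, rfl⟩ := exists_eq_val_add s
  refine (hK.mem_realization_iff (by omega)).mpr ⟨fun v => le_max_left _ _, ?_, k, fun v hv => ?_⟩
  · have := sum_polygonPoint_mul c (by omega) k h0 h1 fun _ => 1
    simpa using this
  · obtain ⟨q, hq, rfl⟩ := CyclicPolytope.exists_eq_add_natCast k v
    rw [CyclicPolytope.add_natCast_sub_val _ hq] at hv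
    have hval : ∀ w : ℕ, w < 2 → k + (q : ZMod n) ≠ k + (w : ZMod n) := fun w hw h => by
      have := congrArg (fun v => (v - k).val) h
      simp only [CyclicPolytope.add_natCast_sub_val k hq,
        CyclicPolytope.add_natCast_sub_val k (show w < n by omega)] at this
      omega
    rw [polygonPoint_apply c (by omega) k _ h0 h1, if_neg (by simpa using hval 0 (by omega)),
      if_neg (by simpa using hval 1 (by omega)), add_zero]

/-- The realization is a finite union of closed sets, one for each arc, and on each of them the mean
position has a continuous lift. -/
theorem IsArcComplex.continuous_meanPosition (hK : K.IsArcComplex c d) (hdn : 2 * d < n) :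
    Continuous fun x : K.realization => meanPosition c d (x : V → ℝ) := by
  refine (locallyFinite_of_finite fun i : ZMod n =>
    {x : K.realization | ∀ k, d < (k - i).val → (x : V → ℝ) (c k) = 0}).continuous ?_ ?_ ?_
  · refine Set.eq_univ_of_forall fun x => Set.mem_iUnion.mpr ?_
    exact ((hK.mem_realization_iff (by omega)).mp x.2).2.2
  · intro i
    simp only [Set.ofPred_forall]
    refine isClosed_iInter fun k => isClosed_iInter fun _ => ?_
    exact isClosed_eq ((continuous_apply _).comp continuous_subtype_val) continuous_const
  · intro i
    refine ContinuousOn.congr (f := fun x : K.realization =>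
      (meanLift c i (x : V → ℝ) : AddCircle (n : ℝ))) ?_ fun x hx => ?_
    · exact ((AddCircle.continuous_mk' _).comp
        ((continuous_meanLift c i).comp continuous_subtype_val)).continuousOn
    · exact meanPosition_eq hdn ((hK.mem_realization_iff (by omega)).mp x.2).2.1 hx

/-- The straight-line homotopy from the identity to the retraction onto the polygon. -/
noncomputable def IsArcComplex.retractionHomotopy (hK : K.IsArcComplex c d) (hd : 1 ≤ d)
    (hdn : 2 * d < n) : C(unitInterval × K.realization, K.realization) where
  toFun p := ⟨fun v => (1 - (p.1 : ℝ)) * (p.2 : V → ℝ) v +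
      p.1 * polygonPoint c (meanPosition c d (p.2 : V → ℝ)) v, by
    obtain ⟨h0, h1, i, hi⟩ := (hK.mem_realization_iff (by omega)).mp p.2.2
    have hp0 := p.1.2.1
    have hp1 := p.1.2.2
    refine (hK.mem_realization_iff (by omega)).mpr ⟨fun v => ?_, ?_, i, fun k hk => ?_⟩
    · exact add_nonneg (mul_nonneg (by linarith) (h0 v)) (mul_nonneg hp0 (le_max_left _ _))
    · rw [sum_add_distrib, ← mul_sum, ← mul_sum, h1, ((hK.mem_realization_iff (by omega)).mp
        (hK.polygonPoint_mem hd hdn _)).2.1]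
      ring
    · rw [hi k hk, polygonPoint_meanPosition_apply hd hdn h0 h1 hi k hk]; ring⟩
  continuous_toFun := by
    refine Continuous.subtype_mk (continuous_pi fun v => ?_) _
    have h1 : Continuous fun p : unitInterval × K.realization =>
        polygonPoint c (meanPosition c d (p.2 : V → ℝ)) v :=
      (continuous_apply v).comp ((continuous_polygonPoint c).comp
        ((hK.continuous_meanPosition hdn).comp continuous_snd))
    have h2 : Continuous fun p : unitInterval × K.realization => (p.2 : V → ℝ) v :=
      (continuous_apply v).comp (continuous_subtype_val.comp continuous_snd)
    fun_prop

theorem polygonPoint_meanPosition_of_mem_cycle (hd : 1 ≤ d) (hdn : 2 * d < n) {x : V → ℝ}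
    (hx : x ∈ (cycle c).realization) : polygonPoint c (meanPosition c d x) = x := by
  obtain ⟨h0, h1, k, hk⟩ := ((isArcComplex_cycle c).mem_realization_iff (by omega)).mp hx
  have hfact : Fact (1 < n) := ⟨by omega⟩
  have hk' : ∀ v, v ≠ k → v ≠ k + 1 → x (c v) = 0 := fun v hv1 hv2 => by
    refine hk v ?_
    obtain ⟨q, hq, rfl⟩ := CyclicPolytope.exists_eq_add_natCast k v
    rw [CyclicPolytope.add_natCast_sub_val _ hq]
    by_contra! hle
    interval_cases q
    · exact hv1 (by simp)
    · exact hv2 (by simp)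
  have hne : k ≠ k + 1 := by simp
  have hsum : x (c k) + x (c (k + 1)) = 1 := by
    rw [← h1, ← sum_pair hne (f := fun v => x (c v))]
    refine sum_subset (subset_univ _) fun v _ hv => ?_
    rw [mem_insert, mem_singleton, not_or] at hv
    exact hk' v hv.1 hv.2
  have heq : polygonPoint c ((k.val + x (c (k + 1)) : ℝ) : AddCircle (n : ℝ)) = x := by
    funext v
    obtain ⟨v, rfl⟩ := c.surjective v
    rw [polygonPoint_apply c (by omega) k v (h0 _) (by linarith [h0 (c k)])]
    by_cases hv1 : v = k
    · subst hv1
      rw [if_pos rfl, if_neg hne]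
      linarith
    by_cases hv2 : v = k + 1
    · subst hv2
      rw [if_neg hv1, if_pos rfl, zero_add]
    · rw [if_neg hv1, if_neg hv2, hk' v hv1 hv2, add_zero]
  rw [← heq, meanPosition_polygonPoint hd hdn]

theorem IsArcComplex.isDeformationRetract (hK : K.IsArcComplex c d) (hd : 1 ≤ d)
    (hdn : 2 * d < n) : IsDeformationRetract (cycle c).realization K.realization := by
  refine ⟨fun x ⟨h0, σ, hσ, h⟩ => ⟨h0, σ, hK.cycle_le hd hσ, h⟩,
    hK.retractionHomotopy hd hdn, fun x => ?_, fun x => ?_, fun s x hx => ?_⟩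
  · ext v
    simp [retractionHomotopy]
  · have : ((hK.retractionHomotopy hd hdn (1, x) : K.realization) : V → ℝ) =
        polygonPoint c (meanPosition c d (x : V → ℝ)) := by
      ext v
      simp [retractionHomotopy]
    rw [this]
    exact (isArcComplex_cycle c).polygonPoint_mem le_rfl (by omega) _
  · ext v
    simp only [retractionHomotopy, ContinuousMap.coe_mk,
      polygonPoint_meanPosition_of_mem_cycle hd hdn hx]
    ring

/-- `meanPosition` is a left inverse of `polygonPoint`, and the retraction homotopy joins the
identity to the other composite. -/
theorem IsArcComplex.nonempty_homotopyEquiv_circle (hK : K.IsArcComplex c d) (hd : 1 ≤ d)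
    (hdn : 2 * d < n) : Nonempty (K.realization ≃ₕ Circle) := by
  let f : C(K.realization, AddCircle (n : ℝ)) :=
    ⟨fun x => meanPosition c d (x : V → ℝ), hK.continuous_meanPosition hdn⟩
  let g : C(AddCircle (n : ℝ), K.realization) :=
    ⟨fun s => ⟨polygonPoint c s, hK.polygonPoint_mem hd hdn s⟩,
      (continuous_polygonPoint c).subtype_mk _⟩
  have hfg : f.comp g = ContinuousMap.id _ :=
    ContinuousMap.ext fun s => meanPosition_polygonPoint hd hdn s
  have H : (ContinuousMap.id K.realization).Homotopy (g.comp f) :=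
    { toContinuousMap := hK.retractionHomotopy hd hdn
      map_zero_left := fun x => by
        ext v
        simp [retractionHomotopy]
      map_one_left := fun x => by
        ext v
        simp [retractionHomotopy, f, g] }
  have e : K.realization ≃ₕ AddCircle (n : ℝ) :=
    { toFun := f
      invFun := g
      left_inv := ⟨H.symm⟩
      right_inv := by rw [hfg] }
  have hn0 : (n : ℝ) ≠ 0 := Nat.cast_ne_zero.mpr (NeZero.ne n)
  exact ⟨e.trans (AddCircle.homeomorphCircle hn0).toHomotopyEquiv⟩

end ArcRealization
end PreAbstractSimplicialComplex

/-! ### The triangulation complex as an arc complex, and the conclusion. -/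

theorem CyclicPolytope.isArcComplex_triangulationComplex {d : ℕ} {t : Fin (2 * d + 3) → ℝ}
    (ht : StrictMono t) :
    (CyclicPolytope.triangulationComplex d t).IsArcComplex (CyclicPolytope.internalEquiv ht) d := by
  intro σ
  rw [CyclicPolytope.mem_triangulationComplex_iff ht]
  simp only [Finset.subset_iff, PreAbstractSimplicialComplex.mem_arc]

theorem mainTheorem12 (d : ℕ) (hd : 2 ≤ d) (t : Fin (2 * d + 3) → ℝ) (ht : StrictMono t) :
    (CyclicPolytope.triangulationComplex d t).IsPureOfDim d ∧
    ¬ (CyclicPolytope.triangulationComplex d t).IsShellable ∧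
    (∃ c : ZMod (2 * d + 3) ≃ CyclicPolytope.InternalSimplex d t,
      PreAbstractSimplicialComplex.cycle c ≤ CyclicPolytope.triangulationComplex d t ∧
      IsDeformationRetract (PreAbstractSimplicialComplex.cycle c).realization
        (CyclicPolytope.triangulationComplex d t).realization) ∧
    Nonempty ((CyclicPolytope.triangulationComplex d t).realization ≃ₕ Circle) := by
  have hK := CyclicPolytope.isArcComplex_triangulationComplex ht
  exact ⟨hK.isPureOfDim (by omega), hK.not_isShellable hd rfl,
    ⟨_, hK.cycle_le (by omega), hK.isDeformationRetract (by omega) (by omega)⟩,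
    hK.nonempty_homotopyEquiv_circle (by omega) (by omega)⟩
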